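/- **Setting.** Let $d\ge 1$, $\varepsilon=1/N$ with $N\in\mathbb N_{\ge1}$, and divide $D=(0,1)^d$ (with periodic identification of opposite faces) into the mesh of cubes of side length $\varepsilon$ with vertices in $\varepsilon\mathbb Z^d$. Let the potential $V$ equal $\beta$ on a nonempty set of mesh cubes and $\alpha$ on all others, where $0\le\alpha\le\beta$ and $\beta\ge c_0\varepsilon^{-2}$ for some $c_0>0$. Let $\mathcal V=H^1_{\rm per}(D)$ (real valued), $(u,v)=\int_D uv$, $a(u,v)=\int_D\nabla u\cdot\nabla v+Vuv$, and $|||v|||=a(v,v)^{1/2}$; write also $|||T|||$ for the induced operator norm. Let $\mathcal A,\mathcal I:\mathcal V\to\mathcal V^*$ be given by $\langle\mathcal Au,v\rangle=a(u,v)$ and $\langle\mathcal Iu,v\rangle=(u,v)$. Let $u_1,u_2,\dots$ be a Hilbert basis of $\mathcal V$ of $L^2$-orthonormal eigenfunctions, $\mathcal Au_i=E^i\,\mathcal Iu_i$, with $E^1\le E^2\le\cdots$. For a mesh node $z$ let $D_z$ be the (periodically extended) cube of side length $2\varepsilon$ centred at $z$, let $P_z:\mathcal V\to H^1_0(D_z)$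 be the $a$-orthogonal projection, and let $\mathcal P=\sum_zP_z$. For a scaling factor $\vartheta\in\mathbb R$ let $\gamma_{\mathcal P}$ be any number with $|||\mathrm{id}-\vartheta\mathcal P|||\le\gamma_{\mathcal P}$. The preconditioner with $m$ inner steps is $\mathcal P_m=\mathrm{id}-(\mathrm{id}-\vartheta\mathcal P)^m$, and $\gamma:=\gamma_{\mathcal P}^m$. Let $K\ge1$ with $\mathrm{gap}:=E^1/E^{K+1}<1$, and let $V^{(0)}=[v_1^{(0)},\dots,v_K^{(0)}]\in\mathcal V^K$, $v^{(0)}_j=\sum_{i\ge1}\alpha_{i,j}u_i$, have an invertible coefficient matrix $\mathcal C=[\alpha_{i,j}]_{i,j=1}^K$. Starting from $\tilde V^{(0)}=V^{(0)}$, define $\tilde V^{(k)}$ by applying the step $v\mapsto v+\mathcal P_m(E^1\mathcal A^{-1}\mathcal Iv-v)$ simultaneously to the $K$ entries of $\tilde V^{(k-1)}$. **Theorem (Convergence of inexact block iteration).** For every $C_1>0$ there is a constant $C>0$, depending only on $C_1$, such that in every setting as above the following holds. Let $0<\mathrm{tol}<1$, let $k\in\mathbb N$ satisfy $k\ge\log(1/\mathrm{tol})/\log(1/\mathrm{gap})$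 (for instance the smallest such integer), and let $m$ be such that $$\gamma=\gamma_{\mathcal P}^m\le\tfrac12(1-\mathrm{gap})\qquad\text{and}\qquad\gamma\le C_1\,\mathrm{gap}^k .$$ Then there is $\tilde v\in\operatorname{span}\tilde V^{(k)}$ with $$|||\tilde v-u_1|||\le C\,\mathrm{tol}\;|||V^{(0)}\mathcal C^{-1}e_1-u_1|||$$ whose support is at most $k\,m$ $\varepsilon$-layers (layers of mesh cubes) larger than the union of the supports of $v^{(0)}_1,\dots,v^{(0)}_K$ (so at most $k^2$ layers if $m\le k$). Moreover, if $m$ is the smallest number of inner steps with these two properties, then $k\,m\le\Lambda k^2$ with $$\Lambda=1+\frac{\log(1/\mathrm{gap})+\log\bigl(2/(1-\mathrm{gap})\bigr)+\log(1+1/C_1)}{\log(1/\gamma_{\mathcal P})}$$ (read as $\Lambda=1$ if $\gamma_{\mathcal P}=0$), a factor that does not depend on $k$ and $\mathrm{tol}$. -/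

import Mathlib

open MeasureTheory Set
open scoped ContDiff

noncomputable section

namespace Schroedinger

/-- The unit cube `D = (0,1)^d`. -/
def cube (d : ℕ) : Set (Fin d → ℝ) := Set.pi Set.univ (fun _ => Set.Ioo (0 : ℝ) 1)

/-- `L²(D)`, real valued. -/
abbrev L2 (d : ℕ) : Type := Lp ℝ 2 ((volume : Measure (Fin d → ℝ)).restrict (cube d))

/-- Smooth `ℤ^d`-periodic functions on `ℝ^d`. -/
def IsSmoothPeriodic {d : ℕ} (φ : (Fin d → ℝ) → ℝ) : Prop :=
  ContDiff ℝ ∞ φ ∧ ∀ (x : Fin d → ℝ) (n : Fin d → ℤ), φ (x + fun i => (n i : ℝ)) = φ x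

/-- The `i`-th partial derivative. -/
def partialDeriv {d : ℕ} (i : Fin d) (φ : (Fin d → ℝ) → ℝ) (x : Fin d → ℝ) : ℝ :=
  fderiv ℝ φ x (Pi.single i 1)

theorem integrable_mul_continuous {d : ℕ} (u : L2 d) {ψ : (Fin d → ℝ) → ℝ}
    (hψ : Continuous ψ) :
    Integrable (fun x => u x * ψ x) ((volume : Measure (Fin d → ℝ)).restrict (cube d)) := by
  have hsub : cube d ⊆ Set.Icc (0 : Fin d → ℝ) 1 := by
    intro x hx
    exact ⟨fun i => (hx i (Set.mem_univ i)).1.le, fun i => (hx i (Set.mem_univ i)).2.le⟩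
  have hfin : IsFiniteMeasure ((volume : Measure (Fin d → ℝ)).restrict (cube d)) :=
    ⟨by
      rw [Measure.restrict_apply_univ]
      exact (measure_mono hsub).trans_lt isCompact_Icc.measure_lt_top⟩
  have hmeas : MeasurableSet (cube d) :=
    MeasurableSet.univ_pi (fun _ => measurableSet_Ioo)
  obtain ⟨C, hC⟩ := (isCompact_Icc (a := (0 : Fin d → ℝ)) (b := 1)).exists_bound_of_continuousOn
    hψ.continuousOn
  have hu : Integrable u ((volume : Measure (Fin d → ℝ)).restrict (cube d)) :=
    (Lp.memLp u).integrable (by norm_num)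
  refine hu.mul_bdd (c := C) hψ.aestronglyMeasurable ?_
  filter_upwards [ae_restrict_mem hmeas] with x hx using hC x (hsub hx)

theorem continuous_partialDeriv {d : ℕ} (i : Fin d) {φ : (Fin d → ℝ) → ℝ}
    (hφ : IsSmoothPeriodic φ) : Continuous (partialDeriv i φ) :=
  (hφ.1.continuous_fderiv (by simp)).clm_apply continuous_const

/-- The space `H¹_per(D)`. An element is a pair `(u, ∇u)`: a function `u ∈ L²(D)` together with
its (unique) weak gradient in `L²(D)^d`, tested with smooth periodic functions. As a subspace of
`L²(D) × L²(D)^d` it carries the `H¹` topology. -/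
def H1per (d : ℕ) : Submodule ℝ (L2 d × (Fin d → L2 d)) where
  carrier := {p | ∀ (i : Fin d) (φ : (Fin d → ℝ) → ℝ), IsSmoothPeriodic φ →
    ∫ x in cube d, p.1 x * partialDeriv i φ x = -∫ x in cube d, p.2 i x * φ x}
  zero_mem' := by
    intro i φ _
    have h0 := Lp.coeFn_zero ℝ 2 ((volume : Measure (Fin d → ℝ)).restrict (cube d))
    have h1 : ∀ ψ : (Fin d → ℝ) → ℝ, ∫ x in cube d, (0 : L2 d) x * ψ x = 0 := by
      intro ψ
      rw [integral_eq_zero_of_ae]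
      filter_upwards [h0] with x hx
      have hx' : (0 : L2 d) x = 0 := hx
      rw [hx', zero_mul, Pi.zero_apply]
    simp only [Prod.fst_zero, Prod.snd_zero, Pi.zero_apply]
    rw [h1, h1, neg_zero]
  add_mem' := by
    intro p q hp hq i φ hφ
    have h1 : ∀ (u v : L2 d) (ψ : (Fin d → ℝ) → ℝ), Continuous ψ →
        ∫ x in cube d, (u + v) x * ψ x
          = (∫ x in cube d, u x * ψ x) + ∫ x in cube d, v x * ψ x := by
      intro u v ψ hψ
      rw [← integral_add (integrable_mul_continuous u hψ) (integrable_mul_continuous v hψ)]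
      refine integral_congr_ae ?_
      filter_upwards [Lp.coeFn_add u v] with x hx
      rw [hx, Pi.add_apply, add_mul]
    simp only [Prod.fst_add, Prod.snd_add, Pi.add_apply]
    rw [h1 _ _ _ (continuous_partialDeriv i hφ), h1 _ _ _ hφ.1.continuous, hp i φ hφ, hq i φ hφ]
    ring
  smul_mem' := by
    intro c p hp i φ hφ
    have h1 : ∀ (u : L2 d) (ψ : (Fin d → ℝ) → ℝ),
        ∫ x in cube d, (c • u) x * ψ x = c * ∫ x in cube d, u x * ψ x := by
      intro u ψ
      rw [← integral_const_mul]
      refine integral_congr_ae ?_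
      filter_upwards [Lp.coeFn_smul c u] with x hx
      rw [hx, Pi.smul_apply, smul_eq_mul, mul_assoc]
    simp only [Prod.smul_fst, Prod.smul_snd, Pi.smul_apply]
    rw [h1, h1, hp i φ hφ]
    ring

/-- The underlying `L²` function of an element of `H¹_per(D)`. -/
def fnOf {d : ℕ} (v : H1per d) : L2 d := v.1.1

/-- The weak partial derivatives of an element of `H¹_per(D)`. -/
def gradOf {d : ℕ} (v : H1per d) (i : Fin d) : L2 d := v.1.2 i

/-- The `L²(D)` inner product `(u, v)`. -/
def l2inner {d : ℕ} (u v : H1per d) : ℝ := inner ℝ (fnOf u) (fnOf v)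

/-- Index, modulo periodicity, of the cube of side length `ε = 1/N` that contains `x`. -/
def cellOf {d : ℕ} (N : ℕ) (x : Fin d → ℝ) : Fin d → ZMod N :=
  fun i => ((⌊(N : ℝ) * x i⌋ : ℤ) : ZMod N)

open Classical in
/-- The potential with value `β` on the mesh cells listed in `Tβ` and `α` on all others. -/
def potential {d : ℕ} (N : ℕ) (Tβ : Set (Fin d → ZMod N)) (α β : ℝ) (x : Fin d → ℝ) : ℝ :=
  if cellOf N x ∈ Tβ then β else α

/-- The bilinear form `a(u, v) = ∫_D ∇u · ∇v + V u v`. -/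
def energyForm {d : ℕ} (V : (Fin d → ℝ) → ℝ) (u v : H1per d) : ℝ :=
  (∑ i, inner ℝ (gradOf u i) (gradOf v i)) + ∫ x in cube d, V x * fnOf u x * fnOf v x

/-- The energy norm `a(v, v)^{1/2}`. -/
def energyNorm {d : ℕ} (V : (Fin d → ℝ) → ℝ) (v : H1per d) : ℝ :=
  Real.sqrt (energyForm V v v)

/-- Norm, with respect to the energy norm, of a (linear, bounded) operator on `H¹_per(D)`. -/
def energyOpNorm {d : ℕ} (V : (Fin d → ℝ) → ℝ) (T : H1per d → H1per d) : ℝ :=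
  ⨆ v : H1per d, energyNorm V (T v) / energyNorm V v

/-- `u 0, u 1, …` is a Hilbert basis of `H¹_per(D)` consisting of `L²`-normalised eigenfunctions
of `-Δ + V`, and `E 0 ≤ E 1 ≤ …` are the eigenvalues, counted with multiplicity. -/
structure IsEigenbasis {d : ℕ} (V : (Fin d → ℝ) → ℝ) (u : ℕ → H1per d) (E : ℕ → ℝ) : Prop where
  eigen : ∀ (i : ℕ) (v : H1per d), energyForm V (u i) v = E i * l2inner (u i) v
  orthonormal : ∀ i j : ℕ, l2inner (u i) (u j) = if i = j then 1 else 0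
  monotone : Monotone E
  complete : (Submodule.span ℝ (Set.range u)).topologicalClosure = ⊤

/-- The interior of the patch `D_z`, the cube of side length `2ε` centred at the node `z`
(`ε = 1/N`), extended periodically to `ℝ^d`. -/
def patch {d : ℕ} (N : ℕ) (z : Fin d → ZMod N) : Set (Fin d → ℝ) :=
  {x | ∃ n : Fin d → ℤ, ∀ i, ((n i : ℤ) : ZMod N) = z i ∧ |(N : ℝ) * x i - (n i : ℝ)| < 1}

/-- The local space `H¹_0(D_z)` inside `H¹_per(D)`: the `H¹`-closure of the smooth functions
supported in the interior of the (periodically extended) patch. -/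
def localSpace {d : ℕ} (N : ℕ) (z : Fin d → ZMod N) : Submodule ℝ (H1per d) :=
  (Submodule.span ℝ {w : H1per d | ∃ φ : (Fin d → ℝ) → ℝ, IsSmoothPeriodic φ ∧
    tsupport φ ⊆ patch N z ∧
    fnOf w =ᵐ[(volume : Measure (Fin d → ℝ)).restrict (cube d)] φ}).topologicalClosure

open Classical in
/-- The `a`-orthogonal projection onto `H¹_0(D_z)`: the (unique) `w ∈ H¹_0(D_z)` with
`a(w, v) = a(u, v)` for all `v ∈ H¹_0(D_z)`. -/
def localProj {d : ℕ} (N : ℕ) (V : (Fin d → ℝ) → ℝ) (z : Fin d → ZMod N) (u : H1per d) :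
    H1per d :=
  if h : ∃ w ∈ localSpace N z, ∀ v ∈ localSpace N z, energyForm V w v = energyForm V u v
  then h.choose else 0

/-- The operator `𝒫 = ∑_z P_z`. -/
def schwarzOp {d : ℕ} (N : ℕ) [NeZero N] (V : (Fin d → ℝ) → ℝ) (u : H1per d) : H1per d :=
  ∑ z : Fin d → ZMod N, localProj N V z u

/-- The operator `id - ϑ 𝒫`. -/
def relaxedResidual {d : ℕ} (N : ℕ) [NeZero N] (V : (Fin d → ℝ) → ℝ) (ϑ : ℝ) (u : H1per d) :
    H1per d :=
  u - ϑ • schwarzOp N V u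

/-- The preconditioner made of `m` steps of `w ↦ w + ϑ 𝒫 (u - w)` started at `w = 0`; as an
operator acting on `u` this is `id - (id - ϑ 𝒫)^m`. -/
def precond {d : ℕ} (N : ℕ) [NeZero N] (V : (Fin d → ℝ) → ℝ) (ϑ : ℝ) (m : ℕ) (u : H1per d) :
    H1per d :=
  (fun w => w + ϑ • schwarzOp N V (u - w))^[m] 0

open Classical in
/-- The operator `𝒜⁻¹ ℐ`: the (unique) `w` with `a(w, v) = (f, v)` for all `v ∈ H¹_per(D)`. -/
def solve {d : ℕ} (V : (Fin d → ℝ) → ℝ) (f : H1per d) : H1per d :=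
  if h : ∃ w : H1per d, ∀ v : H1per d, energyForm V w v = l2inner f v
  then h.choose else 0

/-- One step `v ↦ v + 𝒫_m (E₁ 𝒜⁻¹ ℐ v - v)` of the preconditioned inverse iteration, where `𝒫_m`
is the preconditioner with `m` inner steps. -/
def pinvitStep {d : ℕ} (N : ℕ) [NeZero N] (V : (Fin d → ℝ) → ℝ) (E₁ ϑ : ℝ) (m : ℕ)
    (v : H1per d) : H1per d :=
  v + precond N V ϑ m (E₁ • solve V v - v)

/-- The block obtained from `V₀` by `k` simultaneous preconditioned inverse iteration steps. -/
def pinvitBlock {d K : ℕ} (N : ℕ) [NeZero N] (V : (Fin d → ℝ) → ℝ) (E₁ ϑ : ℝ) (m k : ℕ)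
    (V₀ : Fin K → H1per d) (j : Fin K) : H1per d :=
  (pinvitStep N V E₁ ϑ m)^[k] (V₀ j)

/-- The coefficient matrix `𝒞 = [α_{i,j}]`, `v_j = ∑_i α_{i,j} u_i`, of a block of functions with
respect to the first `K` eigenfunctions. -/
def coeffMatrix {d K : ℕ} (u : ℕ → H1per d) (V₀ : Fin K → H1per d) :
    Matrix (Fin K) (Fin K) ℝ :=
  Matrix.of fun i j => l2inner (u i) (V₀ j)

/-- The linear combination `V₀ x` of the functions of a block. -/
def blockComb {d K : ℕ} (V₀ : Fin K → H1per d) (x : Fin K → ℝ) : H1per d :=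
  ∑ j, x j • V₀ j

/-- The mesh cell `c` meets the (essential) support of `v`. -/
def MeetsCell {d : ℕ} (N : ℕ) (v : H1per d) (c : Fin d → ZMod N) : Prop :=
  ¬ ∀ᵐ x ∂((volume : Measure (Fin d → ℝ)).restrict (cube d)), cellOf N x = c → fnOf v x = 0

/-- The mesh cell `c'` lies in the first `j` layers of cells around the cell `c` (periodically). -/
def WithinLayers {d N : ℕ} (j : ℕ) (c c' : Fin d → ZMod N) : Prop :=
  ∀ i, ∃ t : ℤ, |t| ≤ (j : ℤ) ∧ c' i = c i + (t : ZMod N)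

/-- The support of `v` is at most `j` layers of mesh cells (`ε`-layers) larger than the union of
the supports of the functions of the block `V₀`. -/
def SupportGrowth {d K : ℕ} (N j : ℕ) (V₀ : Fin K → H1per d) (v : H1per d) : Prop :=
  ∀ c' : Fin d → ZMod N, MeetsCell N v c' →
    ∃ c : Fin d → ZMod N, (∃ l, MeetsCell N (V₀ l) c) ∧ WithinLayers j c c'

end Schroedinger

end

/-! Let `q = E 0 / E K` be the gap, `B = E 0 • 𝒜⁻¹ℐ` and `M = (id - ϑ𝒫)^m`, an operator of energy
norm at most `g = γP ^ m`. One inexact step is the linear map `x ↦ B x + M (x - B x)`. It fixes `u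
0`, because `B (u 0) = u 0`. The combination `V₀ 𝒞⁻¹ e₁` has the same first `K` coefficients as `u
0`, so the new error is the `k`-th iterate applied to a vector `r` without low frequencies, and the
claim reduces to a decay of order `q ^ k` for that iterate.

On the high frequencies `B` contracts by `q`, but `M` mixes the frequencies and `B` need not
contract the low ones. In the variable `x` the low part would receive about `g * q ^ j` at step `j`,
which sums to `g / (1 - q)` and destroys the uniformity in the gap. The remedy is to follow the low
part of `y = (1 - M)⁻¹ x`: it changes only through `(1 - B) Q M y`, and `1 - B` is at most `1 - q`
on the low modes. The increments then sum to a multiple of `g`. The high part of `x` and the low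
part of `y` satisfy a coupled recursion (`norm_perturbed_iterate_le`), solved by a weighted Gronwall
argument (`coupled_decay`). The high-frequency contraction must also lose only a multiple of `g * (1
- q)`; this is the spectral estimate `norm_add_mul_norm_le_of_high`, the place where `g ≤ (1 - q) /
2` is essential.

To use spectral calculus, `H¹_per(D)` is renormed by the energy form (`exists_hilbert_model`).
Coercivity comes from positivity of the first eigenvalue and completeness of the eigenfunctions.

The support grows slowly because the global solve is never computed: a local correction needs `a(E₁
𝒜⁻¹ℐ v - w, y) = E₁ (v, y) - a(w, y)` only for local `y`, which vanishes on patches away from the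
supports of `v` and `w`. Hence each inner sweep adds one layer. The bound on `k * m` expresses that
one of the two smallness conditions fails at `m - 1`. -/

noncomputable section

namespace Schroedinger

/-! ### Decay of a perturbed contraction -/

/-- Discrete Gronwall estimate for the high and low frequency errors of a perturbed contraction. -/
theorem coupled_decay {h p : ℕ → ℝ} {q g C₁ : ℝ} {k : ℕ} (hq : 0 < q) (hq1 : q < 1)
    (hg : 0 ≤ g) (hC₁ : 0 < C₁) (hgk : g ≤ C₁ * q ^ k) (hh : ∀ j, 0 ≤ h j) (hp : ∀ j, 0 ≤ p j)
    (hstep : ∀ j, h (j + 1) ≤ (q + 2 * g * (1 - q)) * h j + 2 * g * (1 - q) * p j)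
    (pstep : ∀ j, p (j + 1) ≤ p j + 2 * (1 - q) * g * (p j + h j))
    (p0 : p 0 ≤ 2 * g * h 0) :
    h k + p k ≤ (1 + 2 * C₁) * Real.exp (4 * C₁) * q ^ k * h 0 := by
  have hd : 0 < 1 - q := by linarith
  -- The high part is weighed against its own decay `q ^ j`, the low part against the final accuracy
  -- `q ^ k`. In these weights a step multiplies the sum by at most `1 + 4 * C₁ * (q ^ j - q ^ (j +
  -- 1))`, and the exponent is the telescoped sum of these increments.
  have key : ∀ j ≤ k, h j / q ^ j + p j / q ^ k ≤
      Real.exp (4 * C₁ * (1 - q ^ j)) * ((1 + 2 * C₁) * h 0) := by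
    intro j
    induction j with
    | zero =>
      intro _
      have h1 : p 0 / q ^ k ≤ 2 * C₁ * h 0 := by
        rw [div_le_iff₀ (by positivity)]
        nlinarith [mul_le_mul_of_nonneg_right hgk (hh 0)]
      simp only [pow_zero, div_one, sub_self, mul_zero, Real.exp_zero, one_mul]
      linarith
    | succ j ih =>
      intro hj
      have ih := ih (by omega)
      obtain ⟨r, rfl⟩ : ∃ r, k = j + 1 + r := ⟨k - (j + 1), by omega⟩
      obtain ⟨a, ha⟩ : ∃ a, a = h j / q ^ j := ⟨_, rfl⟩
      obtain ⟨b, hb⟩ : ∃ b, b = p j / q ^ (j + 1 + r) := ⟨_, rfl⟩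
      have ha0 : 0 ≤ a := ha ▸ div_nonneg (hh j) (by positivity)
      have hb0 : 0 ≤ b := hb ▸ div_nonneg (hp j) (by positivity)
      have hja : h j = q ^ j * a := by rw [ha]; field_simp
      have hjb : p j = q ^ (j + 1 + r) * b := by rw [hb]; field_simp
      rw [← ha, ← hb] at ih
      have hqj : 0 < q ^ j := by positivity
      have hqr : q ^ r ≤ 1 := pow_le_one₀ hq.le hq1.le
      have hqr0 : 0 < q ^ r := by positivity
      have e1 : q ^ (j + 1 + r) = q ^ j * q * q ^ r := by ring
      -- The bound `g ≤ C₁ * q ^ k` is spent at three strengths, `q ^ (j + 1)`, `q ^ j` and the full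
      -- `q ^ k`, so that after division by the weights every coupling coefficient is at most `2 *
      -- C₁ * q ^ j * (1 - q)`.
      have hgq : g ≤ C₁ * q ^ j * q := by
        refine hgk.trans ?_
        rw [e1]
        have : q ^ j * q * q ^ r ≤ q ^ j * q * 1 := by gcongr
        nlinarith
      have hgj : g ≤ C₁ * q ^ j := by
        refine hgq.trans ?_
        have : C₁ * q ^ j * q ≤ C₁ * q ^ j * 1 := by gcongr
        linarith
      have s1 : h (j + 1) / q ^ (j + 1) ≤ (1 + 2 * C₁ * q ^ j * (1 - q)) * a
          + 2 * C₁ * q ^ j * (1 - q) * b := by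
        rw [div_le_iff₀ (by positivity)]
        refine (hstep j).trans ?_
        rw [hja, hjb, e1]
        have t1 : g * ((1 - q) * (q ^ j * a)) ≤ C₁ * q ^ j * q * ((1 - q) * (q ^ j * a)) :=
          mul_le_mul_of_nonneg_right hgq (by positivity)
        have t2 : g * ((1 - q) * (q ^ j * q * q ^ r * b)) ≤
            C₁ * q ^ j * ((1 - q) * (q ^ j * q * 1 * b)) := by gcongr
        rw [pow_succ]
        linarith
      have s2 : p (j + 1) / q ^ (j + 1 + r) ≤ b + 2 * (1 - q) * C₁ * q ^ j * b
          + 2 * (1 - q) * C₁ * q ^ j * a := by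
        rw [div_le_iff₀ (by positivity)]
        refine (pstep j).trans ?_
        rw [hja, hjb]
        have t1 : g * ((1 - q) * (q ^ (j + 1 + r) * b)) ≤
          C₁ * q ^ j * ((1 - q) * (q ^ (j + 1 + r) * b)) := by gcongr
        have t2 : g * ((1 - q) * (q ^ j * a)) ≤
          C₁ * q ^ (j + 1 + r) * ((1 - q) * (q ^ j * a)) := by gcongr
        linarith
      have s3 : h (j + 1) / q ^ (j + 1) + p (j + 1) / q ^ (j + 1 + r) ≤
          (4 * C₁ * (q ^ j - q ^ (j + 1)) + 1) * (a + b) := by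
        refine (add_le_add s1 s2).trans (le_of_eq ?_)
        ring
      have s4 : 4 * C₁ * (1 - q ^ (j + 1)) = 4 * C₁ * (q ^ j - q ^ (j + 1)) +
        4 * C₁ * (1 - q ^ j) := by ring
      rw [s4, Real.exp_add, mul_assoc]
      refine s3.trans ?_
      exact mul_le_mul (Real.add_one_le_exp _) ih (by positivity) (by positivity)
  have hk := key k le_rfl
  rw [← add_div, div_le_iff₀ (by positivity)] at hk
  have hexp : Real.exp (4 * C₁ * (1 - q ^ k)) ≤ Real.exp (4 * C₁) := by
    apply Real.exp_le_exp.2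
    have : 0 < q ^ k := by positivity
    nlinarith
  refine hk.trans ?_
  have := mul_le_mul_of_nonneg_right hexp
    (mul_nonneg (mul_nonneg (by positivity : (0 : ℝ) ≤ 1 + 2 * C₁) (hh 0))
      (by positivity : 0 ≤ q ^ k))
  linarith

/-- Decay of the perturbed iteration `x ↦ B x + M (x - B x)` started at a high-frequency vector.
Here `Q` is the projection onto the low frequencies. -/
theorem norm_perturbed_iterate_le {X : Type*} [NormedAddCommGroup X] [NormedSpace ℝ X]
    [CompleteSpace X] (B Q M : X →L[ℝ] X) {q g C₁ : ℝ} {k : ℕ} (hq : 0 < q) (hq1 : q < 1)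
    (hg : 0 ≤ g) (hC₁ : 0 < C₁) (hgd : g ≤ (1 - q) / 2) (hgk : g ≤ C₁ * q ^ k)
    (hM : ∀ x, ‖M x‖ ≤ g * ‖x‖) (hQ : ∀ x, ‖Q x‖ ≤ ‖x‖) (hQ' : ∀ x, ‖x - Q x‖ ≤ ‖x‖)
    (hQQ : ∀ x, Q (Q x) = Q x) (hBQ : ∀ x, Q (B x) = B (Q x)) (hB : ∀ x, ‖B (Q x)‖ ≤ ‖Q x‖)
    (hBlow : ∀ x, ‖Q x - B (Q x)‖ ≤ (1 - q) * ‖Q x‖)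
    (hBhigh : ∀ w, Q w = 0 → ‖B w‖ + g * ‖w - B w‖ ≤ (q + g * (1 - q)) * ‖w‖)
    (r : X) (hr : Q r = 0) :
    ‖(fun x => B x + M (x - B x))^[k] r‖ ≤
      2 * (1 + 2 * C₁) * Real.exp (4 * C₁) * q ^ k * ‖r‖ := by
  set S : X → X := fun x => B x + M (x - B x) with hS
  have hd : 0 < 1 - q := by linarith
  have hg2 : g ≤ 1 / 2 := by linarith
  have hMn : ‖M‖ < 1 := lt_of_le_of_lt (M.opNorm_le_bound hg hM) (by linarith)
  -- Change of variable `y = (1 - M)⁻¹ x`, by a Neumann series. It turns the iteration into `y ↦ y -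
  -- (x - B x)` with `x = y - M y`, which puts the factor `1 - B` in front of everything that
  -- reaches the low modes.
  obtain ⟨y0, hy0⟩ : ∃ y, y - M y = r := by
    obtain ⟨U, hU⟩ := isUnit_one_sub_of_norm_lt_one hMn
    refine ⟨(↑U⁻¹ : X →L[ℝ] X) r, ?_⟩
    have : ((1 - M) * (↑U⁻¹ : X →L[ℝ] X)) r = r := by
      rw [← hU, Units.mul_inv]; rfl
    simpa using this
  set x : ℕ → X := fun j => S^[j] r with hx
  set y : ℕ → X := fun j => (fun y => (y - (y - M y)) + B (y - M y))^[j] y0 with hy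
  have ys : ∀ j, y (j + 1) = (y j - (y j - M (y j))) + B (y j - M (y j)) := fun j => by
    simp only [hy, Function.iterate_succ_apply']
  have xs : ∀ j, x (j + 1) = B (x j) + M (x j - B (x j)) := fun j => by
    simp only [hx, Function.iterate_succ_apply', hS]
  have xy : ∀ j, x j = y j - M (y j) := by
    intro j
    induction j with
    | zero => exact hy0.symm
    | succ j ih =>
      rw [xs, ys, ← ih]
      simp only [map_add, map_sub]
      have : y j - x j = M (y j) := by rw [ih]; abel
      rw [show M (y j) = y j - x j from this.symm]
      abel
  -- The high part of `y` differs from that of `x` by the high part of `M y`, which is absorbed on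
  -- the left because `g ≤ 1 / 2`.
  have hyn : ∀ j, ‖y j‖ ≤ 2 * (‖Q (y j)‖ + ‖x j - Q (x j)‖) := by
    intro j
    have e : y j = Q (y j) + (x j - Q (x j)) + (M (y j) - Q (M (y j))) := by
      rw [xy j]; simp only [map_sub]; abel
    have h1 : ‖y j‖ ≤ ‖Q (y j)‖ + ‖x j - Q (x j)‖ + ‖M (y j) - Q (M (y j))‖ := by
      conv_lhs => rw [e]
      exact norm_add₃_le
    have h2 := (hQ' (M (y j))).trans (hM (y j))
    have h3 : g * ‖y j‖ ≤ 1 / 2 * ‖y j‖ := by gcongr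
    linarith
  have hlow : ∀ j, ‖Q (x j)‖ ≤ 2 * ‖Q (y j)‖ + 2 * g * ‖x j - Q (x j)‖ := by
    intro j
    have h1 : ‖Q (x j)‖ ≤ ‖Q (y j)‖ + ‖Q (M (y j))‖ := by
      rw [xy j, map_sub]; exact norm_sub_le _ _
    have h2 := (hQ (M (y j))).trans (hM (y j))
    have h3 : g * ‖y j‖ ≤ g * (2 * (‖Q (y j)‖ + ‖x j - Q (x j)‖)) := by gcongr; exact hyn j
    have h4 : g * ‖Q (y j)‖ ≤ 1 / 2 * ‖Q (y j)‖ := by gcongr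
    linarith
  have main := coupled_decay (h := fun j => ‖x j - Q (x j)‖) (p := fun j => ‖Q (y j)‖) (k := k)
    hq hq1 hg hC₁ hgk (fun j => norm_nonneg _) (fun j => norm_nonneg _) ?_ ?_ ?_
  · have h0 : ‖x 0 - Q (x 0)‖ = ‖r‖ := by simp [hx, hr]
    simp only [h0] at main
    have h1 : ‖x k‖ ≤ ‖x k - Q (x k)‖ + ‖Q (x k)‖ := by
      conv_lhs => rw [← sub_add_cancel (x k) (Q (x k))]
      exact norm_add_le _ _
    -- Since `2 * g ≤ 1`, high and low parts of `x k` together are at most twice the sum controlled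
    -- by `main`; this is the leading factor 2 of the constant.
    have h2 := hlow k
    have h3 : g * ‖x k - Q (x k)‖ ≤ 1 / 2 * ‖x k - Q (x k)‖ := by gcongr
    change ‖x k‖ ≤ _
    linarith
  · intro j
    set w := x j - Q (x j) with hw
    have hQw : Q w = 0 := by rw [hw, map_sub, hQQ, sub_self]
    have e : x (j + 1) - Q (x (j + 1)) = B w + (M (w - B w) - Q (M (w - B w)))
        + (M (Q (x j) - B (Q (x j))) - Q (M (Q (x j) - B (Q (x j))))) := by
      have e1 : x j = w + Q (x j) := by rw [hw]; abel
      rw [xs]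
      simp only [hw, map_sub, map_add, hBQ]
      abel
    have h1 : ‖x (j + 1) - Q (x (j + 1))‖ ≤ ‖B w‖ + ‖M (w - B w) - Q (M (w - B w))‖
        + ‖M (Q (x j) - B (Q (x j))) - Q (M (Q (x j) - B (Q (x j))))‖ := by
      rw [e]; exact norm_add₃_le
    have h2 := (hQ' (M (w - B w))).trans (hM _)
    have h3 := (hQ' (M (Q (x j) - B (Q (x j))))).trans (hM _)
    -- Of the two terms `g * (1 - q) * ‖w‖` in the recursion, one comes from here and the other from
    -- the low part of `x` in `h5`, after using `2 * g ≤ 1`.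
    have h4 := hBhigh w hQw
    have h5 : g * ‖Q (x j) - B (Q (x j))‖ ≤ g * ((1 - q) * (2 * ‖Q (y j)‖ + 2 * g * ‖w‖)) := by
      gcongr
      exact (hBlow _).trans (by gcongr; exact hlow j)
    have h6 : g * ((1 - q) * (g * ‖w‖)) ≤ 1 / 2 * ((1 - q) * (g * ‖w‖)) := by gcongr
    change _ ≤ (q + 2 * g * (1 - q)) * ‖w‖ + _
    linarith
  · intro j
    -- The perturbation of the low part is `(1 - B) Q M y`, hence at most `(1 - q) * g * ‖y‖`.
    have e : Q (y (j + 1)) = B (Q (y j)) + (Q (M (y j)) - B (Q (M (y j)))) := by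
      rw [ys]; simp only [map_sub, map_add, hBQ]; abel
    have h1 : ‖Q (y (j + 1))‖ ≤ ‖B (Q (y j))‖ + ‖Q (M (y j)) - B (Q (M (y j)))‖ := by
      rw [e]; exact norm_add_le _ _
    have h2 := hB (y j)
    have h3 := hBlow (M (y j))
    have h4 : (1 - q) * ‖Q (M (y j))‖ ≤
        (1 - q) * (g * (2 * (‖Q (y j)‖ + ‖x j - Q (x j)‖))) := by
      gcongr
      exact (hQ _).trans ((hM _).trans (by gcongr; exact hyn j))
    change _ ≤ ‖Q (y j)‖ + _
    linarith
  · have e : Q (y 0) = Q (M (y 0)) := by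
      have := congrArg Q (xy 0)
      have hx0 : Q (x 0) = 0 := hr
      rw [hx0, map_sub] at this
      exact (sub_eq_zero.1 this.symm)
    have hx0 : ‖x 0 - Q (x 0)‖ = ‖r‖ := by simp [hx, hr]
    have h1 : ‖y 0‖ ≤ 2 * ‖r‖ := by
      have e1 : y 0 = x 0 + M (y 0) := by rw [xy 0]; abel
      have h1 : ‖y 0‖ ≤ ‖x 0‖ + ‖M (y 0)‖ := by
        conv_lhs => rw [e1]
        exact norm_add_le _ _
      have h2 := hM (y 0)
      have h3 : g * ‖y 0‖ ≤ 1 / 2 * ‖y 0‖ := by gcongr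
      have h4 : ‖x 0‖ = ‖r‖ := rfl
      linarith
    simp only [hx0]
    rw [e]
    refine ((hQ _).trans (hM _)).trans ?_
    have : g * ‖y 0‖ ≤ g * (2 * ‖r‖) := by gcongr
    linarith

/-! ### Spectral estimates for a diagonal operator -/

section Diagonal

variable {X : Type*} [NormedAddCommGroup X] [InnerProductSpace ℝ X]

theorem hasSum_sq_coord (e : HilbertBasis ℕ ℝ X) (x : X) :
    HasSum (fun i => inner ℝ (e i) x ^ 2) (‖x‖ ^ 2) := by
  have := e.hasSum_inner_mul_inner x x
  rw [real_inner_self_eq_norm_sq] at this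
  refine this.congr_fun fun i => ?_
  rw [real_inner_comm x (e i), sq]

theorem ext_coord (e : HilbertBasis ℕ ℝ X) {x y : X}
    (h : ∀ i, inner ℝ (e i) x = inner ℝ (e i) y) : x = y := by
  have := hasSum_sq_coord e (x - y)
  simp only [inner_sub_right, h, sub_self, ne_eq, OfNat.ofNat_ne_zero, not_false_eq_true,
    zero_pow] at this
  have h0 := this.unique hasSum_zero
  exact sub_eq_zero.1 (norm_eq_zero.1 (pow_eq_zero_iff (two_ne_zero) |>.1 h0))

theorem norm_le_of_coord (e : HilbertBasis ℕ ℝ X) {x y : X} {c : ℝ} (hc : 0 ≤ c)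
    (h : ∀ i, |inner ℝ (e i) x| ≤ c * |inner ℝ (e i) y|) : ‖x‖ ≤ c * ‖y‖ := by
  refine le_of_sq_le_sq ?_ (by positivity)
  rw [mul_pow]
  refine hasSum_le (fun i => ?_) (hasSum_sq_coord e x) ((hasSum_sq_coord e y).mul_left (c ^ 2))
  rw [← sq_abs, ← sq_abs (inner ℝ (e i) y), ← mul_pow]
  exact pow_le_pow_left₀ (abs_nonneg _) (h i) 2

/-- The orthogonal projection onto the first `K` basis vectors. -/
def lowProj (e : HilbertBasis ℕ ℝ X) (K : ℕ) : X →L[ℝ] X :=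
  ∑ i ∈ Finset.range K, (innerSL ℝ (e i)).smulRight (e i)

theorem inner_lowProj (e : HilbertBasis ℕ ℝ X) (K i : ℕ) (x : X) :
    inner ℝ (e i) (lowProj e K x) = if i < K then inner ℝ (e i) x else 0 := by
  have h := orthonormal_iff_ite.1 e.orthonormal
  simp [lowProj, inner_sum, inner_smul_right, h]

/-- The separate bounds `q * ‖w‖` and `‖w‖` would give only `q + g`. The two terms compete: `w - B
w` is large only if `B w` is small. Both are controlled by `t = ⟨B w, w⟩`, through `‖B w‖² ≤ q t`
and `‖w - B w‖² ≤ ‖w‖² - (2 - q) t`. As `t` drops below `q ‖w‖²`, the gain in the first term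
outweighs the loss in the second exactly because `g ≤ (1 - q) / 2`, so the worst case is `B w = q
w`. -/
theorem norm_add_mul_norm_le_of_high (e : HilbertBasis ℕ ℝ X) (B : X →L[ℝ] X) {l : ℕ → ℝ}
    (hl0 : ∀ i, 0 ≤ l i) (hB : ∀ i x, inner ℝ (e i) (B x) = l i * inner ℝ (e i) x)
    {q g : ℝ} (hq : 0 < q) (hq1 : q < 1) (hg : 0 ≤ g) (hgd : g ≤ (1 - q) / 2) (w : X)
    (hw : ∀ i, inner ℝ (e i) w ≠ 0 → l i ≤ q) :
    ‖B w‖ + g * ‖w - B w‖ ≤ (q + g * (1 - q)) * ‖w‖ := by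
  have hww := hasSum_sq_coord e w
  have hBw : HasSum (fun i => l i * inner ℝ (e i) w ^ 2) (inner ℝ (B w) w) := by
    refine (e.hasSum_inner_mul_inner (B w) w).congr_fun fun i => ?_
    rw [real_inner_comm (e i) (B w), hB]; ring
  have hBB := hasSum_sq_coord e (B w)
  simp only [hB] at hBB
  have ht : inner ℝ (B w) w ≤ q * ‖w‖ ^ 2 := by
    refine hasSum_le (fun i => ?_) hBw (hww.mul_left q)
    by_cases h : inner ℝ (e i) w = 0
    · simp [h]
    · exact mul_le_mul_of_nonneg_right (hw i h) (sq_nonneg _)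
  have hb : ‖B w‖ ^ 2 ≤ q * inner ℝ (B w) w := by
    refine hasSum_le (fun i => ?_) hBB (hBw.mul_left q)
    by_cases h : inner ℝ (e i) w = 0
    · simp [h]
    · have := mul_le_mul_of_nonneg_right (hw i h)
        (mul_nonneg (hl0 i) (sq_nonneg (inner ℝ (e i) w)))
      calc _ = l i * (l i * inner ℝ (e i) w ^ 2) := by ring
        _ ≤ _ := this
  have ha : ‖w - B w‖ ^ 2 = ‖w‖ ^ 2 - 2 * inner ℝ (B w) w + ‖B w‖ ^ 2 := by
    rw [norm_sub_sq_real, real_inner_comm]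
  obtain ⟨t, htd⟩ : ∃ t, t = inner ℝ (B w) w := ⟨_, rfl⟩
  obtain ⟨n, hn⟩ : ∃ n, n = ‖w‖ := ⟨_, rfl⟩
  obtain ⟨b, hbd⟩ : ∃ b, b = ‖B w‖ := ⟨_, rfl⟩
  obtain ⟨a, had⟩ : ∃ a, a = ‖w - B w‖ := ⟨_, rfl⟩
  rw [← htd, ← hn] at ht
  rw [← htd, ← hbd] at hb
  rw [← htd, ← hn, ← hbd, ← had] at ha
  rw [← hn, ← hbd, ← had]
  have hn0 : 0 ≤ n := hn ▸ norm_nonneg _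
  have hb0 : 0 ≤ b := hbd ▸ norm_nonneg _
  have ha0 : 0 ≤ a := had ▸ norm_nonneg _
  have hd : 0 < 1 - q := by linarith
  rcases hn0.eq_or_lt with h0 | hpos
  · have hw0 : w = 0 := norm_eq_zero.1 (by rw [← hn, ← h0])
    rw [hbd, had, ← h0, hw0]
    simp
  -- with `t = q n² - s n`, both norms are bounded by their tangents at `s = 0`
  obtain ⟨s, hs⟩ : ∃ s, s = (q * n ^ 2 - t) / n := ⟨_, rfl⟩
  have hts : t = q * n ^ 2 - s * n := by rw [hs]; field_simp; ring
  have hs0 : 0 ≤ s := by rw [hs]; exact div_nonneg (by linarith) hpos.le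
  have ht0 : 0 ≤ t := by
    have : 0 ≤ q * t := le_trans (sq_nonneg b) hb
    nlinarith
  have h1 : b ≤ q * n - s / 2 := by
    have hsn : s ≤ q * n := by
      have : s * n ≤ q * n * n := by nlinarith
      exact le_of_mul_le_mul_right this hpos
    refine le_of_sq_le_sq ?_ (by nlinarith)
    nlinarith [sq_nonneg s]
  have h2 : (1 - q) * a ≤ (1 - q) ^ 2 * n + (2 - q) * s / 2 := by
    refine le_of_sq_le_sq ?_ (by
      have : 0 ≤ 2 - q := by linarith
      positivity)
    have e1 : a ^ 2 ≤ n ^ 2 - (2 - q) * t := by rw [ha]; linarith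
    have e2 : (1 - q) ^ 2 * a ^ 2 ≤ (1 - q) ^ 2 * (n ^ 2 - (2 - q) * t) :=
      mul_le_mul_of_nonneg_left e1 (sq_nonneg _)
    have e3 : (1 - q) ^ 2 * (n ^ 2 - (2 - q) * t) =
        ((1 - q) ^ 2 * n + (2 - q) * s / 2) ^ 2 - ((2 - q) * s / 2) ^ 2 := by
      rw [hts]; ring
    rw [mul_pow]
    nlinarith [sq_nonneg ((2 - q) * s / 2)]
  have h3 : g * a ≤ g * (1 - q) * n + (2 - q) * s / 4 := by
    have hga : g * ((1 - q) * a) ≤ g * ((1 - q) ^ 2 * n + (2 - q) * s / 2) := by gcongr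
    have hgs : g * ((2 - q) * s) ≤ (1 - q) / 2 * ((2 - q) * s) := by
      have : 0 ≤ 2 - q := by linarith
      gcongr
    have : (1 - q) * (g * a) ≤ (1 - q) * (g * (1 - q) * n + (2 - q) * s / 4) := by
      nlinarith
    exact le_of_mul_le_mul_left this hd
  nlinarith

theorem norm_iterate_le_of_diagonal [CompleteSpace X] (e : HilbertBasis ℕ ℝ X) (B M : X →L[ℝ] X)
    {l : ℕ → ℝ} (hl0 : ∀ i, 0 ≤ l i) (hl1 : ∀ i, l i ≤ 1) (hl : Antitone l)
    (hB : ∀ i x, inner ℝ (e i) (B x) = l i * inner ℝ (e i) x)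
    {g C₁ : ℝ} {k K : ℕ} (hq : 0 < l K) (hq1 : l K < 1) (hg : 0 ≤ g) (hC₁ : 0 < C₁)
    (hgd : g ≤ (1 - l K) / 2) (hgk : g ≤ C₁ * l K ^ k) (hM : ∀ x, ‖M x‖ ≤ g * ‖x‖)
    (r : X) (hr : ∀ i < K, inner ℝ (e i) r = 0) :
    ‖(fun x => B x + M (x - B x))^[k] r‖ ≤
      2 * (1 + 2 * C₁) * Real.exp (4 * C₁) * l K ^ k * ‖r‖ := by
  refine norm_perturbed_iterate_le B (lowProj e K) M hq hq1 hg hC₁ hgd hgk hM ?_ ?_ ?_ ?_ ?_ ?_ ?_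
    r ?_
  · intro x
    rw [← one_mul ‖x‖]
    refine norm_le_of_coord e zero_le_one fun i => ?_
    rw [inner_lowProj]; split_ifs <;> simp
  · intro x
    rw [← one_mul ‖x‖]
    refine norm_le_of_coord e zero_le_one fun i => ?_
    rw [inner_sub_right, inner_lowProj]; split_ifs <;> simp
  · intro x
    refine ext_coord e fun i => ?_
    simp only [inner_lowProj]; split_ifs <;> rfl
  · intro x
    refine ext_coord e fun i => ?_
    simp only [inner_lowProj, hB]; split_ifs <;> simp
  · intro x
    rw [← one_mul ‖lowProj e K x‖]
    refine norm_le_of_coord e zero_le_one fun i => ?_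
    rw [hB, abs_mul, abs_of_nonneg (hl0 i)]
    exact mul_le_mul_of_nonneg_right (hl1 i) (abs_nonneg _)
  · intro x
    refine norm_le_of_coord e (by linarith) fun i => ?_
    rw [inner_sub_right, hB]
    by_cases hi : i < K
    · rw [← one_sub_mul, abs_mul, abs_of_nonneg (by linarith [hl1 i])]
      exact mul_le_mul_of_nonneg_right (by linarith [hl hi.le]) (abs_nonneg _)
    · simp [inner_lowProj, hi]
  · intro w hw
    refine norm_add_mul_norm_le_of_high e B hl0 hB hq hq1 hg hgd w fun i hi => ?_
    by_contra! hlt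
    have hiK : i < K := by
      by_contra! h
      exact absurd (hl h) (not_le.2 hlt)
    have := inner_lowProj e K i w
    rw [hw, inner_zero_right, if_pos hiK] at this
    exact hi this.symm
  · refine ext_coord e fun i => ?_
    rw [inner_lowProj, inner_zero_right]
    split_ifs with h
    · exact hr i h
    · rfl

end Diagonal

/-! ### Hilbert space models of coercive forms -/

section Model

universe u

/-- A copy of `E`, to be equipped with the inner product given by a coercive form. -/
def Renormed (E : Type*) : Type _ := E

instance (E : Type*) [AddCommGroup E] : AddCommGroup (Renormed E) :=
  inferInstanceAs (AddCommGroup E)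

instance (E : Type*) [AddCommGroup E] [Module ℝ E] : Module ℝ (Renormed E) :=
  inferInstanceAs (Module ℝ E)

/-- The norm on `H1per` is a maximum norm on a product and comes from no inner product. A bounded
symmetric coercive form is an inner product with an equivalent norm, which makes Riesz
representation and Hilbert bases available. -/
theorem exists_hilbert_model {E : Type u} [NormedAddCommGroup E] [NormedSpace ℝ E]
    [CompleteSpace E] (a : E →L[ℝ] E →L[ℝ] ℝ) (hsymm : ∀ u v, a u v = a v u) {c : ℝ}
    (hc : 0 < c) (hcoer : ∀ v, c * ‖v‖ ^ 2 ≤ a v v) :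
    ∃ (X : Type u) (_ : NormedAddCommGroup X) (_ : InnerProductSpace ℝ X) (_ : CompleteSpace X)
      (Φ : E ≃L[ℝ] X), ∀ u v, inner ℝ (Φ u) (Φ v) = a u v := by
  let core : InnerProductSpace.Core ℝ (Renormed E) :=
    { inner := fun u v => a (show E from u) (show E from v)
      conj_inner_symm := fun u v => hsymm _ _
      re_inner_nonneg := fun u => le_trans (by positivity) (hcoer (show E from u))
      add_left := fun u v w => by
        change a ((show E from u) + (show E from v)) (show E from w) = _
        rw [map_add]; rfl
      smul_left := fun u v r => by
        change a (r • (show E from u)) (show E from v) = _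
        rw [map_smul]; rfl
      definite := fun u hu => by
        have h1 := hcoer (show E from u)
        have h2 : a (show E from u) (show E from u) = 0 := hu
        rw [h2] at h1
        have h3 : ‖(show E from u)‖ ^ 2 ≤ 0 := by
          by_contra! h
          have := mul_pos hc h
          linarith
        exact norm_eq_zero.1 (pow_eq_zero_iff two_ne_zero |>.1 (le_antisymm h3 (sq_nonneg _))) }
  let : NormedAddCommGroup (Renormed E) := core.toNormedAddCommGroup
  let : InnerProductSpace ℝ (Renormed E) := InnerProductSpace.ofCore core.toCore
  have hinner : ∀ u v : E, inner ℝ (show Renormed E from u) (show Renormed E from v) = a u v :=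
    fun u v => rfl
  let ι : E ≃ₗ[ℝ] Renormed E :=
    { toFun := fun v => v, invFun := fun v => v, map_add' := fun _ _ => rfl,
      map_smul' := fun _ _ => rfl, left_inv := fun _ => rfl, right_inv := fun _ => rfl }
  have hnorm : ∀ v : E, ‖ι v‖ ^ 2 = a v v := fun v => by
    rw [← real_inner_self_eq_norm_sq]; rfl
  let Φ : E ≃L[ℝ] Renormed E := ι.toContinuousLinearEquivOfBounds (Real.sqrt ‖a‖)
    (Real.sqrt c)⁻¹ (fun v => by
      refine le_of_sq_le_sq ?_ (by positivity)
      rw [hnorm, mul_pow, Real.sq_sqrt (norm_nonneg a)]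
      calc a v v ≤ ‖a v v‖ := Real.le_norm_self _
        _ ≤ ‖a‖ * ‖v‖ * ‖v‖ := a.le_opNorm₂ v v
        _ = _ := by ring) (fun v => by
      rw [inv_mul_eq_div, le_div_iff₀ (Real.sqrt_pos.2 hc)]
      refine le_of_sq_le_sq ?_ (norm_nonneg _)
      have h := hnorm (ι.symm v)
      rw [LinearEquiv.apply_symm_apply] at h
      rw [h, mul_pow, Real.sq_sqrt hc.le, mul_comm]
      exact hcoer _)
  refine ⟨Renormed E, inferInstance, inferInstance, ?_, Φ, hinner⟩
  exact (completeSpace_congr (e := Φ.toEquiv) Φ.isUniformEmbedding).1 inferInstance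

/-- The Riesz representation theorem on a closed subspace, for a coercive form. -/
theorem exists_riesz {E : Type u} [NormedAddCommGroup E] [NormedSpace ℝ E]
    [CompleteSpace E] (a : E →L[ℝ] E →L[ℝ] ℝ) (hsymm : ∀ u v, a u v = a v u) {c : ℝ}
    (hc : 0 < c) (hcoer : ∀ v, c * ‖v‖ ^ 2 ≤ a v v) (W : Submodule ℝ E)
    (hW : IsClosed (W : Set E)) (f : E →L[ℝ] ℝ) : ∃ w ∈ W, ∀ v ∈ W, a w v = f v := by
  have : CompleteSpace W := hW.completeSpace_coe
  let aW : W →L[ℝ] W →L[ℝ] ℝ := a.bilinearComp W.subtypeL W.subtypeL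
  obtain ⟨X, _, _, _, Φ, hΦ⟩ := exists_hilbert_model aW (fun u v => hsymm _ _) hc
    (fun v => hcoer v)
  let F : X →L[ℝ] ℝ := (f.comp W.subtypeL).comp (Φ.symm : X →L[ℝ] W)
  let w := Φ.symm ((InnerProductSpace.toDual ℝ X).symm F)
  refine ⟨w, w.2, fun v hv => ?_⟩
  have h := hΦ w ⟨v, hv⟩
  rw [ContinuousLinearEquiv.apply_symm_apply, InnerProductSpace.toDual_symm_apply] at h
  have h2 : aW w ⟨v, hv⟩ = a w v := rfl
  rw [← h2, ← h]
  simp [F]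

end Model

/-! ### The energy form -/

section Form

variable {d : ℕ}

instance : IsFiniteMeasure ((volume : Measure (Fin d → ℝ)).restrict (cube d)) := by
  have hsub : cube d ⊆ Set.Icc (0 : Fin d → ℝ) 1 := fun x hx =>
    ⟨fun i => (hx i (Set.mem_univ i)).1.le, fun i => (hx i (Set.mem_univ i)).2.le⟩
  refine ⟨?_⟩
  rw [Measure.restrict_apply_univ]
  exact (measure_mono hsub).trans_lt isCompact_Icc.measure_lt_top

theorem measurableSet_cube : MeasurableSet (cube d) :=
  MeasurableSet.univ_pi (fun _ => measurableSet_Ioo)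

theorem memLp_of_continuous {ψ : (Fin d → ℝ) → ℝ} (hψ : Continuous ψ) :
    MemLp ψ 2 ((volume : Measure (Fin d → ℝ)).restrict (cube d)) := by
  obtain ⟨C, hC⟩ := (isCompact_Icc (a := (0 : Fin d → ℝ)) (b := 1)).exists_bound_of_continuousOn
    hψ.continuousOn
  refine MemLp.of_bound hψ.aestronglyMeasurable C ?_
  filter_upwards [ae_restrict_mem measurableSet_cube] with x hx
  exact hC x ⟨fun i => (hx i (Set.mem_univ i)).1.le, fun i => (hx i (Set.mem_univ i)).2.le⟩

theorem inner_eq_integral_mul (u v : L2 d) : inner ℝ u v = ∫ x in cube d, u x * v x := by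
  rw [L2.inner_def]
  refine integral_congr_ae (Filter.Eventually.of_forall fun x => ?_)
  simp [mul_comm]

theorem integral_mul_eq_inner (u : L2 d) {ψ : (Fin d → ℝ) → ℝ} (hψ : Continuous ψ) :
    ∫ x in cube d, u x * ψ x = inner ℝ u ((memLp_of_continuous hψ).toLp ψ) := by
  rw [inner_eq_integral_mul]
  refine integral_congr_ae ?_
  filter_upwards [(memLp_of_continuous hψ).coeFn_toLp] with x hx
  rw [hx]

/-- Against a fixed smooth test function both sides of the weak derivative identity are `L²` inner
products, hence continuous. -/
theorem isClosed_H1per : IsClosed (H1per d : Set (L2 d × (Fin d → L2 d))) := by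
  have : (H1per d : Set (L2 d × (Fin d → L2 d))) = ⋂ (i : Fin d) (φ : (Fin d → ℝ) → ℝ)
      (_ : IsSmoothPeriodic φ), {p | ∫ x in cube d, p.1 x * partialDeriv i φ x
        = -∫ x in cube d, p.2 i x * φ x} := by
    ext p
    simp only [Set.mem_iInter]
    rfl
  rw [this]
  refine isClosed_iInter fun i => isClosed_iInter fun φ => isClosed_iInter fun hφ => ?_
  simp only [integral_mul_eq_inner _ (continuous_partialDeriv i hφ),
    integral_mul_eq_inner _ hφ.1.continuous]
  exact isClosed_eq (by fun_prop) (by fun_prop)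

instance : CompleteSpace (H1per d) := isClosed_H1per.completeSpace_coe

theorem integrable_weight_mul {V : (Fin d → ℝ) → ℝ} (hV : Measurable V) {b : ℝ}
    (hVb : ∀ x, ‖V x‖ ≤ b) (u v : L2 d) :
    Integrable (fun x => V x * u x * v x)
      ((volume : Measure (Fin d → ℝ)).restrict (cube d)) := by
  have h := (Lp.memLp u).integrable_mul (Lp.memLp v)
  have := h.bdd_mul (c := b) hV.aestronglyMeasurable (Filter.Eventually.of_forall hVb)
  refine this.congr (Filter.Eventually.of_forall fun x => ?_)
  simp [mul_assoc]

theorem abs_weight_integral_le {V : (Fin d → ℝ) → ℝ} (hV : Measurable V) {b : ℝ}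
    (hVb : ∀ x, ‖V x‖ ≤ b) (u v : L2 d) :
    |∫ x in cube d, V x * u x * v x| ≤ b * (‖u‖ * ‖v‖) := by
  have hb : 0 ≤ b := (norm_nonneg _).trans (hVb 0)
  have h1 : ∫ x in cube d, |V x * u x * v x| ≤ ∫ x in cube d, b * (|u| x * |v| x) := by
    refine integral_mono_ae (integrable_weight_mul hV hVb u v).abs
      (((Lp.memLp |u|).integrable_mul (Lp.memLp |v|)).const_mul b) ?_
    filter_upwards [Lp.coeFn_abs u, Lp.coeFn_abs v] with x hu hv
    rw [hu, hv, abs_mul, abs_mul, mul_assoc]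
    exact mul_le_mul_of_nonneg_right (hVb x) (by positivity)
  refine (abs_integral_le_integral_abs).trans (h1.trans ?_)
  rw [integral_const_mul, ← inner_eq_integral_mul]
  refine mul_le_mul_of_nonneg_left ((real_inner_le_norm _ _).trans ?_) hb
  rw [norm_abs_eq_norm, norm_abs_eq_norm]

/-- The energy form as a continuous bilinear form. -/
def energyCLM (V : (Fin d → ℝ) → ℝ) (hV : Measurable V) (b : ℝ) (hVb : ∀ x, ‖V x‖ ≤ b) :
    H1per d →L[ℝ] H1per d →L[ℝ] ℝ :=
  LinearMap.mkContinuous₂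
    (LinearMap.mk₂ ℝ (energyForm V)
      (fun u u' v => by
        have h : ∫ x in cube d, V x * fnOf (u + u') x * fnOf v x =
            (∫ x in cube d, V x * fnOf u x * fnOf v x)
              + ∫ x in cube d, V x * fnOf u' x * fnOf v x := by
          rw [← integral_add (integrable_weight_mul hV hVb _ _)
            (integrable_weight_mul hV hVb _ _)]
          refine integral_congr_ae ?_
          filter_upwards [Lp.coeFn_add (fnOf u) (fnOf u')] with x hx
          have : fnOf (u + u') x = fnOf u x + fnOf u' x := hx
          rw [this]; ring
        have h2 : ∀ i, gradOf (u + u') i = gradOf u i + gradOf u' i := fun i => rfl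
        simp only [energyForm, h, h2, inner_add_left, Finset.sum_add_distrib]
        ring)
      (fun c u v => by
        have h : ∫ x in cube d, V x * fnOf (c • u) x * fnOf v x =
            c * ∫ x in cube d, V x * fnOf u x * fnOf v x := by
          rw [← integral_const_mul]
          refine integral_congr_ae ?_
          filter_upwards [Lp.coeFn_smul c (fnOf u)] with x hx
          have : fnOf (c • u) x = c * fnOf u x := hx
          rw [this]; ring
        have h2 : ∀ i, gradOf (c • u) i = c • gradOf u i := fun i => rfl
        simp only [energyForm, h, h2, real_inner_smul_left, ← Finset.mul_sum, smul_eq_mul]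
        ring)
      (fun u v v' => by
        have h : ∫ x in cube d, V x * fnOf u x * fnOf (v + v') x =
            (∫ x in cube d, V x * fnOf u x * fnOf v x)
              + ∫ x in cube d, V x * fnOf u x * fnOf v' x := by
          rw [← integral_add (integrable_weight_mul hV hVb _ _)
            (integrable_weight_mul hV hVb _ _)]
          refine integral_congr_ae ?_
          filter_upwards [Lp.coeFn_add (fnOf v) (fnOf v')] with x hx
          have : fnOf (v + v') x = fnOf v x + fnOf v' x := hx
          rw [this]; ring
        have h2 : ∀ i, gradOf (v + v') i = gradOf v i + gradOf v' i := fun i => rfl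
        simp only [energyForm, h, h2, inner_add_right, Finset.sum_add_distrib]
        ring)
      (fun c u v => by
        have h : ∫ x in cube d, V x * fnOf u x * fnOf (c • v) x =
            c * ∫ x in cube d, V x * fnOf u x * fnOf v x := by
          rw [← integral_const_mul]
          refine integral_congr_ae ?_
          filter_upwards [Lp.coeFn_smul c (fnOf v)] with x hx
          have : fnOf (c • v) x = c * fnOf v x := hx
          rw [this]; ring
        have h2 : ∀ i, gradOf (c • v) i = c • gradOf v i := fun i => rfl
        simp only [energyForm, h, h2, real_inner_smul_right, ← Finset.mul_sum, smul_eq_mul]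
        ring))
    (d + b) (fun u v => by
      change ‖energyForm V u v‖ ≤ _
      have hf : ∀ w : H1per d, ‖fnOf w‖ ≤ ‖w‖ := fun w => norm_fst_le w.1
      have hgr : ∀ (w : H1per d) i, ‖gradOf w i‖ ≤ ‖w‖ := fun w i =>
        (norm_le_pi_norm w.1.2 i).trans (norm_snd_le w.1)
      have hb : 0 ≤ b := (norm_nonneg _).trans (hVb 0)
      have h1 : |∑ i, inner ℝ (gradOf u i) (gradOf v i)| ≤ d * (‖u‖ * ‖v‖) := by
        refine (Finset.abs_sum_le_sum_abs _ _).trans ?_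
        have : ∀ i ∈ Finset.univ, |inner ℝ (gradOf u i) (gradOf v i)| ≤ ‖u‖ * ‖v‖ :=
          fun i _ => (abs_real_inner_le_norm _ _).trans (by gcongr <;> apply hgr)
        refine (Finset.sum_le_sum this).trans ?_
        simp
      have h2 : |∫ x in cube d, V x * fnOf u x * fnOf v x| ≤ b * (‖u‖ * ‖v‖) :=
        (abs_weight_integral_le hV hVb _ _).trans (by gcongr <;> apply hf)
      rw [Real.norm_eq_abs]
      refine (abs_add_le _ _).trans ((add_le_add h1 h2).trans (le_of_eq (by ring))))

theorem energyCLM_apply {V : (Fin d → ℝ) → ℝ} (hV : Measurable V) {b : ℝ}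
    (hVb : ∀ x, ‖V x‖ ≤ b) (u v : H1per d) : energyCLM V hV b hVb u v = energyForm V u v := rfl

theorem energyForm_comm (V : (Fin d → ℝ) → ℝ) (u v : H1per d) :
    energyForm V u v = energyForm V v u := by
  simp only [energyForm]
  congr 1
  · exact Finset.sum_congr rfl fun i _ => real_inner_comm _ _
  · refine integral_congr_ae (Filter.Eventually.of_forall fun x => ?_)
    simp only; ring

theorem grad_sq_le_energyForm {V : (Fin d → ℝ) → ℝ} (hV0 : ∀ x, 0 ≤ V x) (v : H1per d)
    (i : Fin d) : ‖gradOf v i‖ ^ 2 ≤ energyForm V v v := by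
  have h1 : ‖gradOf v i‖ ^ 2 ≤ ∑ i, inner ℝ (gradOf v i) (gradOf v i) := by
    rw [← real_inner_self_eq_norm_sq]
    exact Finset.single_le_sum (f := fun i => inner ℝ (gradOf v i) (gradOf v i))
      (fun j _ => real_inner_self_nonneg) (Finset.mem_univ i)
  have h2 : 0 ≤ ∫ x in cube d, V x * fnOf v x * fnOf v x :=
    integral_nonneg fun x => by
      simp only [Pi.zero_apply]
      rw [mul_assoc]; exact mul_nonneg (hV0 x) (mul_self_nonneg _)
  unfold energyForm
  linarith

theorem weight_le_energyForm (V : (Fin d → ℝ) → ℝ) (v : H1per d) :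
    ∫ x in cube d, V x * fnOf v x * fnOf v x ≤ energyForm V v v := by
  have : 0 ≤ ∑ i, inner ℝ (gradOf v i) (gradOf v i) :=
    Finset.sum_nonneg fun j _ => real_inner_self_nonneg
  unfold energyForm
  linarith

/-- The `L²` inner product as a continuous bilinear form on `H¹_per(D)`. -/
def l2CLM (d : ℕ) : H1per d →L[ℝ] H1per d →L[ℝ] ℝ :=
  (innerSL ℝ).bilinearComp
    ((ContinuousLinearMap.fst ℝ (L2 d) (Fin d → L2 d)).comp (H1per d).subtypeL)
    ((ContinuousLinearMap.fst ℝ (L2 d) (Fin d → L2 d)).comp (H1per d).subtypeL)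

theorem l2CLM_apply (u v : H1per d) : l2CLM d u v = l2inner u v := rfl

end Form

/-! ### Fourier completeness and weak gradients -/

section Trigonometric

variable {d : ℕ}

/-- The phase `2π n · x`. -/
def phase (n : Fin d → ℤ) (x : Fin d → ℝ) : ℝ := ∑ i, 2 * Real.pi * n i * x i

theorem hasFDerivAt_phase (n : Fin d → ℤ) (x : Fin d → ℝ) :
    HasFDerivAt (phase n) (∑ i, (2 * Real.pi * n i) •
      (ContinuousLinearMap.proj i : (Fin d → ℝ) →L[ℝ] ℝ)) x := by
  have : phase n = fun x => (∑ i, (2 * Real.pi * n i) •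
      (ContinuousLinearMap.proj i : (Fin d → ℝ) →L[ℝ] ℝ)) x := by
    ext x; simp [phase]
  rw [this]
  exact ContinuousLinearMap.hasFDerivAt _

theorem contDiff_phase (n : Fin d → ℤ) : ContDiff ℝ ∞ (phase n) := by
  unfold phase; fun_prop

theorem phase_add (n : Fin d → ℤ) (x : Fin d → ℝ) (m : Fin d → ℤ) :
    phase n (x + fun i => (m i : ℝ)) = phase n x + ((∑ i, n i * m i : ℤ) : ℝ) * (2 * Real.pi) := by
  simp only [phase, Pi.add_apply]
  push_cast
  rw [Finset.sum_mul, ← Finset.sum_add_distrib]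
  exact Finset.sum_congr rfl fun i _ => by ring

theorem isSmoothPeriodic_cos (n : Fin d → ℤ) :
    IsSmoothPeriodic fun x => Real.cos (phase n x) :=
  ⟨Real.contDiff_cos.comp (contDiff_phase n), fun x m => by
    simp only [phase_add, Real.cos_add_int_mul_two_pi]⟩

theorem isSmoothPeriodic_sin (n : Fin d → ℤ) :
    IsSmoothPeriodic fun x => Real.sin (phase n x) :=
  ⟨Real.contDiff_sin.comp (contDiff_phase n), fun x m => by
    simp only [phase_add, Real.sin_add_int_mul_two_pi]⟩

theorem partialDeriv_cos (n : Fin d → ℤ) (i : Fin d) (x : Fin d → ℝ) :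
    partialDeriv i (fun x => Real.cos (phase n x)) x =
      -(2 * Real.pi * n i) * Real.sin (phase n x) := by
  rw [partialDeriv, ((hasFDerivAt_phase n x).cos).fderiv]
  simp [Pi.single_apply]
  ring

theorem partialDeriv_sin (n : Fin d → ℤ) (i : Fin d) (x : Fin d → ℝ) :
    partialDeriv i (fun x => Real.sin (phase n x)) x =
      2 * Real.pi * n i * Real.cos (phase n x) := by
  rw [partialDeriv, ((hasFDerivAt_phase n x).sin).fderiv]
  simp [Pi.single_apply]
  ring

attribute [local instance] instMeasureSpaceUnitAddCircle
  instIsProbabilityMeasureUnitAddCircleVolume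

/-- The torus is parametrised by a half-open box, which differs from the open cube by a null set of
faces. -/
theorem restrict_cube_eq : (volume : Measure (Fin d → ℝ)).restrict (cube d) =
    (volume : Measure (Fin d → ℝ)).restrict
      {x : Fin d → ℝ | ∀ i, x i ∈ Ioc ((0 : Fin d → ℝ) i) ((0 : Fin d → ℝ) i + 1)} := by
  refine Measure.restrict_congr_set ?_
  have h1 : cube d =ᵐ[volume] Set.Icc (0 : Fin d → ℝ) 1 :=
    Measure.univ_pi_Ioo_ae_eq_Icc (μ := fun _ : Fin d => (volume : Measure ℝ))
  have h2 : (Set.univ.pi fun i : Fin d => Set.Ioc (0 : ℝ) 1) =ᵐ[volume]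
      Set.Icc (0 : Fin d → ℝ) 1 :=
    Measure.univ_pi_Ioc_ae_eq_Icc (μ := fun _ : Fin d => (volume : Measure ℝ))
      (f := (0 : Fin d → ℝ)) (g := (1 : Fin d → ℝ))
  have h3 : {x : Fin d → ℝ | ∀ i, x i ∈ Ioc ((0 : Fin d → ℝ) i) ((0 : Fin d → ℝ) i + 1)} =
      (Set.univ.pi fun i : Fin d => Set.Ioc (0 : ℝ) 1) := by
    ext x; simp
  rw [h3]
  exact h1.trans h2.symm

theorem mFourier_coe (n : Fin d → ℤ) (x : Fin d → ℝ) :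
    UnitAddTorus.mFourier n (fun i => (x i : UnitAddCircle)) =
      Real.cos (phase n x) + Real.sin (phase n x) * Complex.I := by
  simp only [UnitAddTorus.mFourier, ContinuousMap.coe_mk, fourier_coe_apply]
  rw [← Complex.exp_sum, Complex.ofReal_cos, Complex.ofReal_sin, ← Complex.exp_mul_I]
  congr 1
  simp only [phase]
  push_cast
  rw [Finset.sum_mul]
  exact Finset.sum_congr rfl fun i _ => by ring

/-- The trigonometric functions are complete in `L²(D)`. -/
theorem eq_zero_of_trig (f : L2 d)
    (hcos : ∀ n : Fin d → ℤ, ∫ x in cube d, f x * Real.cos (phase n x) = 0)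
    (hsin : ∀ n : Fin d → ℤ, ∫ x in cube d, f x * Real.sin (phase n x) = 0) : f = 0 := by
  -- `f` is transported to the torus as a complex function; all its Fourier coefficients vanish, and
  -- Parseval gives `f = 0`.
  let F : UnitAddTorus (Fin d) → ℂ := fun t =>
    ((f (UnitAddTorus.measurableEquivPiIoc (0 : Fin d → ℝ) t).1 : ℝ) : ℂ)
  have hmp := (measurePreserving_subtype_coe (μa := (volume : Measure (Fin d → ℝ)))
    (MeasurableSet.univ_pi' (fun i => measurableSet_Ioc (a := (0 : Fin d → ℝ) i)
      (b := (0 : Fin d → ℝ) i + 1)))).comp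
    (UnitAddTorus.measurePreserving_equivPiIoc (0 : Fin d → ℝ))
  have hf : MemLp f 2 ((volume : Measure (Fin d → ℝ)).restrict
      {x : Fin d → ℝ | ∀ i, x i ∈ Ioc ((0 : Fin d → ℝ) i) ((0 : Fin d → ℝ) i + 1)}) := by
    rw [← restrict_cube_eq]; exact Lp.memLp f
  have hF : MemLp F 2 (volume : Measure (UnitAddTorus (Fin d))) :=
    (hf.comp_measurePreserving hmp).ofReal
  have hFx : ∀ x ∈ {x : Fin d → ℝ | ∀ i, x i ∈ Ioc ((0 : Fin d → ℝ) i)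
      ((0 : Fin d → ℝ) i + 1)}, F (fun i => (x i : UnitAddCircle)) = (f x : ℝ) := by
    intro x hx
    have := (UnitAddTorus.measurableEquivPiIoc (0 : Fin d → ℝ)).apply_symm_apply ⟨x, hx⟩
    rw [UnitAddTorus.coe_symm_measurableEquivPiIoc_apply] at this
    simp only [F]
    rw [this]
  have hcube : ∀ {x : Fin d → ℝ}, x ∈ cube d →
      ∀ i, x i ∈ Ioc ((0 : Fin d → ℝ) i) ((0 : Fin d → ℝ) i + 1) := fun {x} hx i => by
    have := hx i (Set.mem_univ i)
    simpa using (⟨this.1, this.2.le⟩ : 0 < x i ∧ x i ≤ 1)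
  have hcoeff : ∀ n, UnitAddTorus.mFourierCoeff (hF.toLp F) n = 0 := by
    intro n
    have e1 : UnitAddTorus.mFourierCoeff (hF.toLp F) n = UnitAddTorus.mFourierCoeff F n := by
      refine integral_congr_ae ?_
      filter_upwards [hF.coeFn_toLp] with t ht
      rw [ht]
    rw [e1, UnitAddTorus.mFourierCoeff_eq_integral F n 0]
    have e2 : ∫ x in {x : Fin d → ℝ | ∀ i, x i ∈ Ioc ((0 : Fin d → ℝ) i)
        ((0 : Fin d → ℝ) i + 1)}, UnitAddTorus.mFourier (-n) (fun i => (x i : UnitAddCircle)) •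
          F (fun i => (x i : UnitAddCircle)) =
        ∫ x in cube d, (((f x * Real.cos (phase (-n) x) : ℝ) : ℂ) +
          ((f x * Real.sin (phase (-n) x) : ℝ) : ℂ) * Complex.I) := by
      rw [← restrict_cube_eq]
      refine setIntegral_congr_fun measurableSet_cube fun x hx => ?_
      simp only [hFx x (hcube hx), mFourier_coe, smul_eq_mul]
      push_cast
      ring
    rw [e2, integral_add, integral_mul_const, integral_complex_ofReal, integral_complex_ofReal,
      hcos, hsin]
    · simp
    · exact (integrable_mul_continuous f
        (Real.continuous_cos.comp (contDiff_phase (-n)).continuous)).ofReal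
    · exact ((integrable_mul_continuous f
        (Real.continuous_sin.comp (contDiff_phase (-n)).continuous)).ofReal).mul_const _
  have hsum := UnitAddTorus.hasSum_sq_mFourierCoeff (hF.toLp F)
  simp only [hcoeff, norm_zero, ne_eq, OfNat.ofNat_ne_zero, not_false_eq_true, zero_pow] at hsum
  have h0 : ∫ t, ‖F t‖ ^ 2 = 0 := by
    rw [← hsum.unique hasSum_zero]
    refine integral_congr_ae ?_
    filter_upwards [hF.coeFn_toLp] with t ht
    rw [ht]
  rw [UnitAddTorus.integral_preimage _ (0 : Fin d → ℝ)] at h0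
  have h1 : (inner ℝ f f : ℝ) = 0 := by
    rw [inner_eq_integral_mul, ← h0, ← restrict_cube_eq]
    refine setIntegral_congr_fun measurableSet_cube fun x hx => ?_
    simp only [hFx x (hcube hx)]
    rw [Complex.norm_real, Real.norm_eq_abs, sq_abs, sq]
  exact inner_self_eq_zero.1 h1

/-- Smooth periodic test functions separate the points of `L²(D)`. -/
theorem eq_zero_of_test (f : L2 d)
    (h : ∀ φ, IsSmoothPeriodic φ → ∫ x in cube d, f x * φ x = 0) : f = 0 :=
  eq_zero_of_trig f (fun n => h _ (isSmoothPeriodic_cos n)) (fun n => h _ (isSmoothPeriodic_sin n))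

theorem volume_real_cube : (volume : Measure (Fin d → ℝ)).real (cube d) = 1 := by
  simp [Measure.real, cube, Real.volume_pi_Ioo]

/-- The integral of a derivative of a periodic function over a period vanishes. -/
theorem integral_partialDeriv_eq_zero (i : Fin d) {φ : (Fin d → ℝ) → ℝ}
    (hφ : IsSmoothPeriodic φ) : ∫ x in cube d, partialDeriv i φ x = 0 := by
  cases d with
  | zero => exact i.elim0
  | succ n =>
    have hIcc : (volume : Measure (Fin (n + 1) → ℝ)).restrict (cube (n + 1)) =
        volume.restrict (Set.Icc (0 : Fin (n + 1) → ℝ) 1) := by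
      refine Measure.restrict_congr_set ?_
      exact Measure.univ_pi_Ioo_ae_eq_Icc (μ := fun _ : Fin (n + 1) => (volume : Measure ℝ))
    have hdiff : ∀ x, HasFDerivAt φ (fderiv ℝ φ x) x := fun x =>
      (hφ.1.differentiable (by simp)).differentiableAt.hasFDerivAt
    have hsum : ∀ x, ∑ j, (if j = i then fderiv ℝ φ x else 0) (Pi.single j 1) =
        partialDeriv i φ x := fun x => by
      rw [Finset.sum_eq_single i]
      · simp [partialDeriv]
      · intro j _ hj; simp [hj]
      · simp
    -- Divergence theorem for the field `φ` times the `i`-th unit vector; the two faces orthogonal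
    -- to direction `i` cancel by periodicity.
    have h := integral_divergence_of_hasFDerivAt_off_countable' (E := ℝ)
      (0 : Fin (n + 1) → ℝ) 1 (fun _ => zero_le_one)
      (fun j => if j = i then φ else fun _ => 0)
      (fun j x => if j = i then fderiv ℝ φ x else 0) ∅ Set.countable_empty
      (fun j => by
        split_ifs
        · exact hφ.1.continuous.continuousOn
        · exact continuousOn_const)
      (fun x _ j => by
        split_ifs
        · exact hdiff x
        · exact hasFDerivAt_const _ _)
      (by
        simp only [hsum]
        exact (continuous_partialDeriv i hφ).continuousOn.integrableOn_compact isCompact_Icc)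
    simp only [hsum] at h
    rw [hIcc, h]
    refine Finset.sum_eq_zero fun j _ => ?_
    by_cases hj : j = i
    · subst hj
      simp only [if_true, sub_eq_zero]
      refine integral_congr_ae (Filter.Eventually.of_forall fun x => ?_)
      have e : (j.insertNth ((1 : Fin (n + 1) → ℝ) j) x : Fin (n + 1) → ℝ) =
          j.insertNth ((0 : Fin (n + 1) → ℝ) j) x +
            fun l => ((Pi.single j 1 : Fin (n + 1) → ℤ) l : ℝ) := by
        ext l
        refine Fin.succAboveCases j ?_ (fun l => ?_) l
        · simp
        · simp
      simp only
      rw [e, hφ.2]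
    · simp [hj]

/-- A function with vanishing weak gradient is constant. -/
theorem ae_const_of_grad_eq_zero (v : H1per d) (hv : ∀ i, gradOf v i = 0) :
    ∃ c : ℝ, fnOf v =ᵐ[(volume : Measure (Fin d → ℝ)).restrict (cube d)] fun _ => c := by
  have hweak : ∀ i φ, IsSmoothPeriodic φ → ∫ x in cube d, fnOf v x * partialDeriv i φ x = 0 := by
    intro i φ hφ
    have h := v.2 i φ hφ
    have h2 : ∫ x in cube d, v.1.2 i x * φ x = 0 := by
      have : v.1.2 i = 0 := hv i
      rw [integral_mul_eq_inner _ hφ.1.continuous, this, inner_zero_left]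
    rw [h2, neg_zero] at h
    exact h
  -- The cube has volume 1, so `c` is the mean, and subtracting it removes the zero Fourier mode.
  set c := ∫ x in cube d, fnOf v x with hc
  have hmem : MemLp (fun _ : Fin d → ℝ => c) 2
    ((volume : Measure (Fin d → ℝ)).restrict (cube d)) := memLp_const c
  let w : L2 d := fnOf v - hmem.toLp _
  have hw : ∀ ψ : (Fin d → ℝ) → ℝ, Continuous ψ → ∫ x in cube d, w x * ψ x =
      (∫ x in cube d, fnOf v x * ψ x) - c * ∫ x in cube d, ψ x := by
    intro ψ hψ
    rw [← integral_const_mul, ← integral_sub (integrable_mul_continuous _ hψ)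
      (((memLp_of_continuous hψ).integrable (by norm_num)).const_mul c)]
    refine integral_congr_ae ?_
    filter_upwards [Lp.coeFn_sub (fnOf v) (hmem.toLp _), hmem.coeFn_toLp] with x h1 h2
    rw [h1, Pi.sub_apply, h2]; ring
  have hw1 : ∀ i φ, IsSmoothPeriodic φ → ∫ x in cube d, w x * partialDeriv i φ x = 0 := by
    intro i φ hφ
    rw [hw _ (continuous_partialDeriv i hφ), hweak i φ hφ, integral_partialDeriv_eq_zero i hφ]
    simp
  -- Every nonconstant cosine or sine mode is, up to a nonzero factor, a partial derivative of the
  -- other, so it is covered by `hw1`.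
  have hmode : ∀ (ψ : (Fin d → ℝ) → ℝ) (r : ℝ), r ≠ 0 →
      ∫ x in cube d, w x * (r * ψ x) = 0 → ∫ x in cube d, w x * ψ x = 0 := by
    intro ψ r hr h
    have h3 : r * ∫ x in cube d, w x * ψ x = 0 := by
      rw [← integral_const_mul, ← h]
      exact integral_congr_ae (Filter.Eventually.of_forall fun x => by simp only; ring)
    exact (mul_eq_zero.1 h3).resolve_left hr
  have hw0 : w = 0 := by
    refine eq_zero_of_trig w (fun n => ?_) (fun n => ?_)
    · by_cases hn : n = 0
      · subst hn
        rw [hw (fun x => Real.cos (phase 0 x))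
          (Real.continuous_cos.comp (contDiff_phase 0).continuous)]
        simp [phase, volume_real_cube, hc]
      · obtain ⟨i, hi⟩ := Function.ne_iff.1 hn
        have h1 := hw1 i _ (isSmoothPeriodic_sin n)
        simp only [partialDeriv_sin] at h1
        exact hmode _ _ (mul_ne_zero (by positivity) (Int.cast_ne_zero.2 hi)) h1
    · by_cases hn : n = 0
      · subst hn
        simp [phase]
      · obtain ⟨i, hi⟩ := Function.ne_iff.1 hn
        have h1 := hw1 i _ (isSmoothPeriodic_cos n)
        simp only [partialDeriv_cos] at h1
        exact hmode _ _ (neg_ne_zero.2 (mul_ne_zero (by positivity) (Int.cast_ne_zero.2 hi))) h1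
  refine ⟨c, ?_⟩
  have : fnOf v = hmem.toLp _ := sub_eq_zero.1 hw0
  rw [this]
  exact hmem.coeFn_toLp

theorem IsSmoothPeriodic.mul {φ ψ : (Fin d → ℝ) → ℝ} (hφ : IsSmoothPeriodic φ)
    (hψ : IsSmoothPeriodic ψ) : IsSmoothPeriodic fun x => φ x * ψ x :=
  ⟨hφ.1.mul hψ.1, fun x n => by simp only [hφ.2, hψ.2]⟩

theorem IsSmoothPeriodic.partialDeriv {φ : (Fin d → ℝ) → ℝ} (hφ : IsSmoothPeriodic φ)
    (i : Fin d) : IsSmoothPeriodic (partialDeriv i φ) := by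
  refine ⟨(hφ.1.fderiv_right (by simp)).clm_apply contDiff_const, fun x n => ?_⟩
  have h : (fun y => φ (y + fun i => (n i : ℝ))) = φ := funext fun y => hφ.2 y n
  have h2 := fderiv_comp_add_right (𝕜 := ℝ) (f := φ) (x := x) (fun i => (n i : ℝ))
  rw [h] at h2
  simp only [Schroedinger.partialDeriv]
  rw [h2]

/-- The weak gradient of an element of `H¹_per(D)` with a smooth representative is the classical
gradient. -/
theorem gradOf_ae_eq {w : H1per d} {φ : (Fin d → ℝ) → ℝ} (hφ : IsSmoothPeriodic φ)
    (hw : fnOf w =ᵐ[(volume : Measure (Fin d → ℝ)).restrict (cube d)] φ) (i : Fin d) :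
    gradOf w i =ᵐ[(volume : Measure (Fin d → ℝ)).restrict (cube d)] partialDeriv i φ := by
  have hmem := memLp_of_continuous (continuous_partialDeriv i hφ)
  -- Classical integration by parts, in the form that the derivative of `φ * ψ` has integral zero,
  -- identifies both gradients on all test functions.
  have h0 : gradOf w i - hmem.toLp _ = 0 := by
    refine eq_zero_of_test _ fun ψ hψ => ?_
    have h1 : ∫ x in cube d, φ x * partialDeriv i ψ x = -∫ x in cube d, gradOf w i x * ψ x := by
      rw [← show _ = -∫ x in cube d, gradOf w i x * ψ x from w.2 i ψ hψ]
      refine integral_congr_ae ?_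
      filter_upwards [hw] with x hx
      have : w.1.1 x = φ x := hx
      rw [this]
    have h2 := integral_partialDeriv_eq_zero i (hφ.mul hψ)
    have h3 : ∀ x, partialDeriv i (fun x => φ x * ψ x) x =
        φ x * partialDeriv i ψ x + partialDeriv i φ x * ψ x := fun x => by
      simp only [partialDeriv]
      rw [fderiv_fun_mul (hφ.1.differentiable (by simp)).differentiableAt
        (hψ.1.differentiable (by simp)).differentiableAt]
      simp [mul_comm]
    have hint : ∀ {f g : (Fin d → ℝ) → ℝ}, Continuous f → Continuous g →
        Integrable (fun x => f x * g x)
          ((volume : Measure (Fin d → ℝ)).restrict (cube d)) := fun hf hg =>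
      (memLp_of_continuous (hf.mul hg)).integrable (by norm_num)
    simp only [h3] at h2
    rw [integral_add (hint hφ.1.continuous (continuous_partialDeriv i hψ))
      (hint (continuous_partialDeriv i hφ) hψ.1.continuous), h1] at h2
    have h4 : ∫ x in cube d, (gradOf w i - hmem.toLp _ : L2 d) x * ψ x =
        (∫ x in cube d, gradOf w i x * ψ x) - ∫ x in cube d, partialDeriv i φ x * ψ x := by
      rw [← integral_sub (integrable_mul_continuous _ hψ.1.continuous)
        (hint (continuous_partialDeriv i hφ) hψ.1.continuous)]
      refine integral_congr_ae ?_
      filter_upwards [Lp.coeFn_sub (gradOf w i) (hmem.toLp _), hmem.coeFn_toLp] with x h1 h2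
      rw [h1, Pi.sub_apply, h2]; ring
    rw [h4]; linarith
  rw [sub_eq_zero.1 h0]
  exact hmem.coeFn_toLp

end Trigonometric

/-! ### The potential and positivity of the eigenvalues -/

section Potential

variable {d N : ℕ}

theorem measurableSet_cellOf_mem (N : ℕ) (T : Set (Fin d → ZMod N)) :
    MeasurableSet {x : Fin d → ℝ | cellOf N x ∈ T} := by
  have h : Measurable fun (x : Fin d → ℝ) (i : Fin d) => ⌊(N : ℝ) * x i⌋ :=
    measurable_pi_lambda _ fun i => Int.measurable_floor.comp
      (measurable_const.mul (measurable_pi_apply i))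
  exact h (Set.to_countable {n : Fin d → ℤ | (fun i => (n i : ZMod N)) ∈ T}).measurableSet

theorem measurable_potential (N : ℕ) (T : Set (Fin d → ZMod N)) (α β : ℝ) :
    Measurable (potential N T α β) :=
  Measurable.ite (measurableSet_cellOf_mem N T) measurable_const measurable_const

theorem potential_nonneg {T : Set (Fin d → ZMod N)} {α β : ℝ} (hα : 0 ≤ α) (hαβ : α ≤ β)
    (x : Fin d → ℝ) : 0 ≤ potential N T α β x := by
  unfold potential; split_ifs <;> linarith

theorem norm_potential_le {T : Set (Fin d → ZMod N)} {α β : ℝ} (hα : 0 ≤ α) (hαβ : α ≤ β)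
    (x : Fin d → ℝ) : ‖potential N T α β x‖ ≤ β := by
  rw [Real.norm_of_nonneg (potential_nonneg hα hαβ x)]
  unfold potential; split_ifs <;> linarith

theorem exists_cell_measure_pos [NeZero N] (c : Fin d → ZMod N) :
    ∃ O ⊆ cube d, MeasurableSet O ∧ 0 < (volume : Measure (Fin d → ℝ)) O ∧
      ∀ x ∈ O, cellOf N x = c := by
  have hN : (0 : ℝ) < N := Nat.cast_pos.2 (NeZero.pos N)
  refine ⟨Set.pi Set.univ fun i => Set.Ioo (((c i).val : ℝ) / N) (((c i).val + 1 : ℝ) / N),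
    fun x hx i hi => ?_, MeasurableSet.univ_pi fun _ => measurableSet_Ioo, ?_, fun x hx => ?_⟩
  · have h := hx i hi
    refine ⟨lt_of_le_of_lt (by positivity) h.1, h.2.trans_le ?_⟩
    rw [div_le_one hN]
    exact_mod_cast ZMod.val_lt (c i)
  · refine (isOpen_set_pi Set.finite_univ fun _ _ => isOpen_Ioo).measure_pos _ ?_
    refine Set.univ_pi_nonempty_iff.2 fun i => Set.nonempty_Ioo.2 ?_
    gcongr
    linarith
  · ext i
    have h := hx i (Set.mem_univ i)
    have hfl : ⌊(N : ℝ) * x i⌋ = ((c i).val : ℤ) := by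
      rw [Int.floor_eq_iff]
      have h1 := (div_lt_iff₀ hN).1 h.1
      have h2 := (lt_div_iff₀ hN).1 h.2
      push_cast
      constructor <;> linarith
    simp [cellOf, hfl]

/-- A nonpositive eigenvalue forces both parts of the energy of `u i` to vanish. The function is
then constant, and the constant is zero because the potential equals `β > 0` on a cell of positive
measure; this contradicts the normalisation. -/
theorem eigenvalue_pos [NeZero N] {T : Set (Fin d → ZMod N)} (hT : T.Nonempty) {α β : ℝ}
    (hα : 0 ≤ α) (hαβ : α ≤ β) (hβ : 0 < β) {u : ℕ → H1per d} {E : ℕ → ℝ}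
    (hE : IsEigenbasis (potential N T α β) u E) (i : ℕ) : 0 < E i := by
  have hEi : energyForm (potential N T α β) (u i) (u i) = E i := by
    rw [hE.eigen, hE.orthonormal, if_pos rfl, mul_one]
  have hw0 : 0 ≤ fun x => potential N T α β x * fnOf (u i) x * fnOf (u i) x := fun x => by
    simp only [Pi.zero_apply]
    rw [mul_assoc]
    exact mul_nonneg (potential_nonneg hα hαβ x) (mul_self_nonneg _)
  by_contra! hle
  have hgrad : ∀ j, gradOf (u i) j = 0 := fun j => by
    have h := grad_sq_le_energyForm (potential_nonneg (T := T) hα hαβ) (u i) j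
    rw [hEi] at h
    exact norm_eq_zero.1 (pow_eq_zero_iff two_ne_zero |>.1
      (le_antisymm (h.trans hle) (sq_nonneg _)))
  obtain ⟨r, hr⟩ := ae_const_of_grad_eq_zero (u i) hgrad
  have hint : ∫ x in cube d, potential N T α β x * fnOf (u i) x * fnOf (u i) x = 0 :=
    le_antisymm ((weight_le_energyForm _ (u i)).trans (hEi.le.trans hle))
      (integral_nonneg hw0)
  have hae := (integral_eq_zero_iff_of_nonneg hw0 (integrable_weight_mul
    (measurable_potential N T α β) (norm_potential_le hα hαβ) _ _)).1 hint
  obtain ⟨c, hc⟩ := hT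
  obtain ⟨O, hO, hOm, hOpos, hOc⟩ := exists_cell_measure_pos c
  have hr0 : r = 0 := by
    by_contra hne
    have hnull : ∀ᵐ x ∂(volume : Measure (Fin d → ℝ)).restrict (cube d), x ∉ O := by
      filter_upwards [hae, hr] with x h1 h2 hx
      rw [h2] at h1
      have hV : potential N T α β x = β := by
        unfold potential; rw [if_pos (by rw [hOc x hx]; exact hc)]
      rw [hV] at h1
      exact (mul_ne_zero (mul_ne_zero hβ.ne' hne) hne) h1
    have h3 : (volume : Measure (Fin d → ℝ)).restrict (cube d) O = 0 := by
      simpa [ae_iff] using hnull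
    rw [Measure.restrict_apply hOm, Set.inter_eq_left.2 hO] at h3
    exact hOpos.ne' h3
  have hzero : fnOf (u i) = 0 := by
    rw [Lp.eq_zero_iff_ae_eq_zero]
    rw [hr0] at hr
    exact hr
  have h1 := hE.orthonormal i i
  rw [if_pos rfl, l2inner, hzero, inner_zero_left] at h1
  exact zero_ne_one h1

end Potential

/-! ### Coercivity, local projections and operator norms -/

section Coercive

variable {d : ℕ}

/-- Potentials with a bounded and coercive energy form. -/
structure CoercivePotential (V : (Fin d → ℝ) → ℝ) : Prop where
  measurable : Measurable V
  bounded : ∃ b, ∀ x, ‖V x‖ ≤ b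
  coercive : ∃ c > 0, ∀ v : H1per d, c * ‖v‖ ^ 2 ≤ energyForm V v v

/-- On finite combinations of eigenfunctions both forms are diagonal; the general case follows by
density and continuity. -/
theorem l2_le_energyForm {V : (Fin d → ℝ) → ℝ} (hV : Measurable V) {b : ℝ}
    (hVb : ∀ x, ‖V x‖ ≤ b) {u : ℕ → H1per d} {E : ℕ → ℝ} (hE : IsEigenbasis V u E)
    (v : H1per d) : E 0 * l2inner v v ≤ energyForm V v v := by
  have hclosed : IsClosed {v : H1per d | E 0 * l2inner v v ≤ energyForm V v v} := by
    simp only [← l2CLM_apply, ← energyCLM_apply hV hVb]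
    exact isClosed_le (by fun_prop) (by fun_prop)
  have hspan : (Submodule.span ℝ (Set.range u) : Set (H1per d)) ⊆
      {v : H1per d | E 0 * l2inner v v ≤ energyForm V v v} := by
    intro v hv
    obtain ⟨c, rfl⟩ := (Finsupp.mem_span_range_iff_exists_finsupp).1 hv
    simp only [Set.mem_ofPred_eq, Finsupp.sum]
    have h1 : ∀ w : H1per d, l2inner (∑ i ∈ c.support, c i • u i) w =
        ∑ i ∈ c.support, c i * l2inner (u i) w := fun w => by
      simp [← l2CLM_apply]
    have h2 : ∀ i ∈ c.support, l2inner (u i) (∑ j ∈ c.support, c j • u j) = c i := fun i hi => by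
      simp only [← l2CLM_apply, map_sum, map_smul]
      simp only [l2CLM_apply, hE.orthonormal]
      simp
      tauto
    have h3 : ∀ w, energyForm V (∑ i ∈ c.support, c i • u i) w =
        ∑ i ∈ c.support, c i * (E i * l2inner (u i) w) := fun w => by
      rw [← energyCLM_apply hV hVb, map_sum, sum_apply]
      refine Finset.sum_congr rfl fun i _ => ?_
      rw [map_smul, smul_apply, energyCLM_apply, hE.eigen, smul_eq_mul]
    rw [h3, h1, Finset.mul_sum]
    refine Finset.sum_le_sum fun i hi => ?_
    rw [h2 i hi]
    nlinarith [mul_le_mul_of_nonneg_right (hE.monotone (Nat.zero_le i)) (mul_self_nonneg (c i))]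
  have hmem : v ∈ (Submodule.span ℝ (Set.range u)).topologicalClosure := by
    rw [hE.complete]; trivial
  exact closure_minimal hspan hclosed hmem

/-- The energy controls the gradient directly and the `L²` part through the first eigenvalue, so no
Poincaré inequality is needed. The constant is a minimum of two because the norm is a maximum of the
components. -/
theorem coercivePotential_of_eigenbasis {V : (Fin d → ℝ) → ℝ} (hV : Measurable V) {b : ℝ}
    (hV0 : ∀ x, 0 ≤ V x) (hVb : ∀ x, ‖V x‖ ≤ b) {u : ℕ → H1per d} {E : ℕ → ℝ}
    (hE : IsEigenbasis V u E) (hpos : 0 < E 0) : CoercivePotential V := by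
  refine ⟨hV, ⟨b, hVb⟩, min (E 0) 1, lt_min hpos one_pos, fun v => ?_⟩
  have h1 := l2_le_energyForm hV hVb hE v
  have ha : 0 ≤ energyForm V v v := by
    refine le_trans (mul_nonneg hpos.le ?_) h1
    exact real_inner_self_nonneg
  obtain ⟨m, hm⟩ : ∃ m, m = min (E 0) 1 := ⟨_, rfl⟩
  have hm0 : 0 < m := hm ▸ lt_min hpos one_pos
  have hmE : m ≤ E 0 := hm ▸ min_le_left _ _
  have hm1 : m ≤ 1 := hm ▸ min_le_right _ _
  rw [← hm]
  have hnorm : ‖v‖ ≤ Real.sqrt (energyForm V v v / m) := by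
    change ‖v.1‖ ≤ _
    rw [Prod.norm_def]
    refine max_le (Real.le_sqrt_of_sq_le ?_)
      ((pi_norm_le_iff_of_nonneg (Real.sqrt_nonneg _)).2 fun i => Real.le_sqrt_of_sq_le ?_)
    · rw [le_div_iff₀ hm0]
      have h2 : l2inner v v = ‖v.1.1‖ ^ 2 := real_inner_self_eq_norm_sq _
      rw [h2] at h1
      nlinarith [sq_nonneg ‖v.1.1‖]
    · rw [le_div_iff₀ hm0]
      have h2 : ‖v.1.2 i‖ ^ 2 ≤ energyForm V v v := grad_sq_le_energyForm hV0 v i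
      nlinarith [sq_nonneg ‖v.1.2 i‖]
  calc m * ‖v‖ ^ 2 ≤ m * Real.sqrt (energyForm V v v / m) ^ 2 := by gcongr
    _ = energyForm V v v := by rw [Real.sq_sqrt (by positivity)]; field_simp

namespace CoercivePotential

variable {V : (Fin d → ℝ) → ℝ} (h : CoercivePotential V)
include h

theorem exists_form : ∃ a : H1per d →L[ℝ] H1per d →L[ℝ] ℝ, ∀ u v, a u v = energyForm V u v := by
  obtain ⟨b, hb⟩ := h.bounded
  exact ⟨energyCLM V h.measurable b hb, energyCLM_apply h.measurable hb⟩

theorem exists_model : ∃ (X : Type) (_ : NormedAddCommGroup X) (_ : InnerProductSpace ℝ X)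
    (_ : CompleteSpace X) (Φ : H1per d ≃L[ℝ] X),
    (∀ u v, inner ℝ (Φ u) (Φ v) = energyForm V u v) ∧ ∀ v, ‖Φ v‖ = energyNorm V v := by
  obtain ⟨a, ha⟩ := h.exists_form
  obtain ⟨c, hc, hcoer⟩ := h.coercive
  obtain ⟨X, _, _, _, Φ, hΦ⟩ := exists_hilbert_model a
    (fun u v => by rw [ha, ha, energyForm_comm]) hc (fun v => by rw [ha]; exact hcoer v)
  have hin : ∀ u v, inner ℝ (Φ u) (Φ v) = energyForm V u v := fun u v => by rw [hΦ, ha]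
  refine ⟨X, _, _, ‹_›, Φ, hin, fun v => ?_⟩
  rw [norm_eq_sqrt_real_inner, hin]
  rfl

theorem exists_riesz (W : Submodule ℝ (H1per d)) (hW : IsClosed (W : Set (H1per d)))
    (f : H1per d →L[ℝ] ℝ) : ∃ w ∈ W, ∀ v ∈ W, energyForm V w v = f v := by
  obtain ⟨a, ha⟩ := h.exists_form
  obtain ⟨c, hc, hcoer⟩ := h.coercive
  simp only [← ha]
  exact Schroedinger.exists_riesz a
    (fun u v => by rw [ha, ha, energyForm_comm]) hc (fun v => by rw [ha]; exact hcoer v) W hW f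

theorem add_left (u v w : H1per d) :
    energyForm V (u + v) w = energyForm V u w + energyForm V v w := by
  obtain ⟨a, ha⟩ := h.exists_form
  simp only [← ha, map_add, add_apply]

theorem smul_left (r : ℝ) (v w : H1per d) :
    energyForm V (r • v) w = r * energyForm V v w := by
  obtain ⟨a, ha⟩ := h.exists_form
  simp only [← ha, map_smul, smul_apply, smul_eq_mul]

theorem sub_left (u v w : H1per d) :
    energyForm V (u - v) w = energyForm V u w - energyForm V v w := by
  obtain ⟨a, ha⟩ := h.exists_form
  simp only [← ha, map_sub, sub_apply]

theorem unique_riesz {W : Submodule ℝ (H1per d)} {w w' : H1per d} (hw : w ∈ W) (hw' : w' ∈ W)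
    (heq : ∀ v ∈ W, energyForm V w v = energyForm V w' v) : w = w' := by
  obtain ⟨c, hc, hcoer⟩ := h.coercive
  have h1 := hcoer (w - w')
  rw [h.sub_left, heq _ (W.sub_mem hw hw'), sub_self] at h1
  have h2 : ‖w - w'‖ ^ 2 ≤ 0 := by
    by_contra! h3
    linarith [mul_pos hc h3]
  exact sub_eq_zero.1 (norm_eq_zero.1 (pow_eq_zero_iff two_ne_zero |>.1
    (le_antisymm h2 (sq_nonneg _))))

/-- Riesz representation on the closed local space excludes the default value `0` in the definition
of `localProj`. -/
theorem localProj_spec (N : ℕ) (z : Fin d → ZMod N) (u : H1per d) :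
    localProj N V z u ∈ localSpace N z ∧
      ∀ v ∈ localSpace N z, energyForm V (localProj N V z u) v = energyForm V u v := by
  obtain ⟨a, ha⟩ := h.exists_form
  have hex : ∃ w ∈ localSpace N z, ∀ v ∈ localSpace N z, energyForm V w v = energyForm V u v := by
    have := h.exists_riesz (localSpace N z) (Submodule.isClosed_topologicalClosure _) (a u)
    simpa only [ha] using this
  rw [localProj, dif_pos hex]
  exact hex.choose_spec

theorem solve_spec (f v : H1per d) : energyForm V (solve V f) v = l2inner f v := by
  have hex : ∃ w : H1per d, ∀ v : H1per d, energyForm V w v = l2inner f v := by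
    obtain ⟨w, -, hw⟩ := h.exists_riesz ⊤ isClosed_univ (l2CLM d f)
    exact ⟨w, fun v => hw v trivial⟩
  rw [solve, dif_pos hex]
  exact hex.choose_spec v

theorem localProj_add (N : ℕ) (z : Fin d → ZMod N) (u v : H1per d) :
    localProj N V z (u + v) = localProj N V z u + localProj N V z v := by
  refine h.unique_riesz (h.localProj_spec N z _).1
    (Submodule.add_mem _ (h.localProj_spec N z _).1 (h.localProj_spec N z _).1) fun w hw => ?_
  rw [h.add_left, (h.localProj_spec N z _).2 w hw, (h.localProj_spec N z _).2 w hw,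
    (h.localProj_spec N z _).2 w hw, h.add_left]

theorem localProj_smul (N : ℕ) (z : Fin d → ZMod N) (r : ℝ) (v : H1per d) :
    localProj N V z (r • v) = r • localProj N V z v := by
  refine h.unique_riesz (h.localProj_spec N z _).1
    (Submodule.smul_mem _ _ (h.localProj_spec N z _).1) fun w hw => ?_
  rw [h.smul_left, (h.localProj_spec N z _).2 w hw, (h.localProj_spec N z _).2 w hw, h.smul_left]

theorem solve_add (u v : H1per d) : solve V (u + v) = solve V u + solve V v := by
  refine h.unique_riesz (W := ⊤) trivial trivial fun w _ => ?_
  rw [h.add_left, h.solve_spec, h.solve_spec, h.solve_spec]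
  simp [← l2CLM_apply]

theorem solve_smul (r : ℝ) (v : H1per d) : solve V (r • v) = r • solve V v := by
  refine h.unique_riesz (W := ⊤) trivial trivial fun w _ => ?_
  rw [h.smul_left, h.solve_spec, h.solve_spec]
  simp [← l2CLM_apply]

theorem schwarzOp_add (N : ℕ) [NeZero N] (u v : H1per d) :
    schwarzOp N V (u + v) = schwarzOp N V u + schwarzOp N V v := by
  simp only [schwarzOp, h.localProj_add, Finset.sum_add_distrib]

theorem schwarzOp_smul (N : ℕ) [NeZero N] (r : ℝ) (v : H1per d) :
    schwarzOp N V (r • v) = r • schwarzOp N V v := by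
  simp only [schwarzOp, h.localProj_smul, Finset.smul_sum]

theorem energyNorm_localProj_le (N : ℕ) (z : Fin d → ZMod N) (v : H1per d) :
    energyNorm V (localProj N V z v) ≤ energyNorm V v := by
  obtain ⟨X, _, _, _, Φ, hin, hnorm⟩ := h.exists_model
  obtain ⟨hmem, hspec⟩ := h.localProj_spec N z v
  rw [← hnorm, ← hnorm]
  have h1 : ‖Φ (localProj N V z v)‖ * ‖Φ (localProj N V z v)‖ ≤
      ‖Φ v‖ * ‖Φ (localProj N V z v)‖ := by
    rw [← real_inner_self_eq_norm_mul_norm, hin, hspec _ hmem, ← hin]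
    exact real_inner_le_norm _ _
  rcases (norm_nonneg (Φ (localProj N V z v))).eq_or_lt with h0 | h0
  · rw [← h0]; exact norm_nonneg _
  · exact le_of_mul_le_mul_right h1 h0

theorem energyNorm_schwarzOp_le (N : ℕ) [NeZero N] (v : H1per d) :
    energyNorm V (schwarzOp N V v) ≤ Fintype.card (Fin d → ZMod N) * energyNorm V v := by
  obtain ⟨X, _, _, _, Φ, hin, hnorm⟩ := h.exists_model
  rw [← hnorm, schwarzOp, map_sum]
  refine (norm_sum_le _ _).trans ?_
  refine (Finset.sum_le_sum fun z _ => ?_).trans_eq (b := ∑ _z : Fin d → ZMod N, energyNorm V v) ?_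
  · rw [hnorm]; exact h.energyNorm_localProj_le N z v
  · rw [Finset.sum_const, nsmul_eq_mul, Finset.card_univ]

theorem energyNorm_relaxedResidual_le (N : ℕ) [NeZero N] {ϑ g : ℝ}
    (hg : energyOpNorm V (relaxedResidual N V ϑ) ≤ g) (v : H1per d) :
    energyNorm V (relaxedResidual N V ϑ v) ≤ g * energyNorm V v := by
  obtain ⟨X, _, _, _, Φ, hin, hnorm⟩ := h.exists_model
  have hbd : ∀ v, energyNorm V (relaxedResidual N V ϑ v) ≤
      (1 + |ϑ| * Fintype.card (Fin d → ZMod N)) * energyNorm V v := fun v => by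
    have h1 := h.energyNorm_schwarzOp_le N v
    simp only [← hnorm] at h1 ⊢
    rw [relaxedResidual, map_sub, map_smul]
    refine (norm_sub_le _ _).trans ?_
    rw [norm_smul, Real.norm_eq_abs]
    nlinarith [mul_le_mul_of_nonneg_left h1 (abs_nonneg ϑ)]
  -- A real supremum over an unbounded set is `0`, so the hypothesis on `energyOpNorm` bounds the
  -- operator only once the quotients are known to be bounded.
  have hba : BddAbove (Set.range fun v : H1per d =>
      energyNorm V (relaxedResidual N V ϑ v) / energyNorm V v) := by
    refine ⟨1 + |ϑ| * Fintype.card (Fin d → ZMod N), ?_⟩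
    rintro _ ⟨v, rfl⟩
    exact div_le_of_le_mul₀ (Real.sqrt_nonneg _) (by positivity) (hbd v)
  have h1 := (le_ciSup hba v).trans hg
  rcases (Real.sqrt_nonneg (energyForm V v v)).eq_or_lt with h0 | h0
  -- Here the quotient is `0 / 0 = 0` and carries no information; the a priori bound takes over.
  · have h2 := hbd v
    have h3 : energyNorm V v = 0 := h0.symm
    rw [h3, mul_zero] at h2 ⊢
    exact h2
  · exact (div_le_iff₀ h0).1 h1

end CoercivePotential

theorem energyOpNorm_nonneg (V : (Fin d → ℝ) → ℝ) (T : H1per d → H1per d) :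
    0 ≤ energyOpNorm V T :=
  Real.iSup_nonneg fun _ => div_nonneg (Real.sqrt_nonneg _) (Real.sqrt_nonneg _)

end Coercive

/-! ### Convergence of the iteration and number of inner steps -/

section Convergence

variable {d : ℕ} {V : (Fin d → ℝ) → ℝ}

namespace CoercivePotential

variable (h : CoercivePotential V)

/-- `id - ϑ 𝒫` as a linear map. -/
def residualLinear (h : CoercivePotential V) (N : ℕ) [NeZero N] (ϑ : ℝ) :
    H1per d →ₗ[ℝ] H1per d where
  toFun := relaxedResidual N V ϑ
  map_add' u v := by simp only [relaxedResidual, h.schwarzOp_add, smul_add]; abel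
  map_smul' r v := by
    simp only [relaxedResidual, h.schwarzOp_smul, RingHom.id_apply, smul_sub, smul_comm ϑ r]

/-- `𝒜⁻¹ ℐ` as a linear map. -/
def solveLinear (h : CoercivePotential V) : H1per d →ₗ[ℝ] H1per d where
  toFun := solve V
  map_add' := h.solve_add
  map_smul' := h.solve_smul

include h

theorem residualLinear_pow_apply (N : ℕ) [NeZero N] (ϑ : ℝ) (m : ℕ) (v : H1per d) :
    (h.residualLinear N ϑ ^ m) v = (relaxedResidual N V ϑ)^[m] v :=
  Module.End.pow_apply _ _ _

omit h in
theorem precond_eq (N : ℕ) [NeZero N] (ϑ : ℝ) (m : ℕ) (f : H1per d) :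
    precond N V ϑ m f = f - (relaxedResidual N V ϑ)^[m] f := by
  induction m with
  | zero => simp [precond]
  | succ m ih =>
    rw [precond] at ih ⊢
    rw [Function.iterate_succ_apply', ih, Function.iterate_succ_apply', sub_sub_cancel]
    simp only [relaxedResidual]
    abel

/-- This is the form `B v + M (v - B v)` of the abstract iteration, with `B = E₁ 𝒜⁻¹ℐ` and `M = (id
- ϑ𝒫)^m`. -/
theorem pinvitStep_eq (N : ℕ) [NeZero N] (E₁ ϑ : ℝ) (m : ℕ) (v : H1per d) :
    pinvitStep N V E₁ ϑ m v = E₁ • solve V v +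
      (h.residualLinear N ϑ ^ m) (v - E₁ • solve V v) := by
  rw [pinvitStep, precond_eq, ← h.residualLinear_pow_apply,
    ← neg_sub v (E₁ • solve V v), map_neg]
  abel

/-- The iteration step as a linear map. -/
def stepLinear (h : CoercivePotential V) (N : ℕ) [NeZero N] (E₁ ϑ : ℝ) (m : ℕ) :
    H1per d →ₗ[ℝ] H1per d where
  toFun := pinvitStep N V E₁ ϑ m
  map_add' u v := by
    have e : u + v - E₁ • (solve V u + solve V v) =
      (u - E₁ • solve V u) + (v - E₁ • solve V v) := by rw [smul_add]; abel
    simp only [h.pinvitStep_eq, h.solve_add]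
    rw [e, map_add, smul_add]
    abel
  map_smul' r v := by
    have e : r • v - E₁ • (r • solve V v) = r • (v - E₁ • solve V v) := by
      rw [smul_sub, smul_comm]
    simp only [h.pinvitStep_eq, h.solve_smul, RingHom.id_apply]
    rw [e, map_smul, smul_add, smul_comm E₁ r]

theorem stepLinear_pow_apply (N : ℕ) [NeZero N] (E₁ ϑ : ℝ) (m k : ℕ) (v : H1per d) :
    (h.stepLinear N E₁ ϑ m ^ k) v = (pinvitStep N V E₁ ϑ m)^[k] v :=
  Module.End.pow_apply _ _ _

theorem solve_eigen {u : ℕ → H1per d} {E : ℕ → ℝ} (hE : IsEigenbasis V u E) (i : ℕ) :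
    E i • solve V (u i) = u i := by
  refine h.unique_riesz (W := ⊤) trivial trivial fun v _ => ?_
  rw [h.smul_left, h.solve_spec, hE.eigen]

theorem energyNorm_residual_pow_le (N : ℕ) [NeZero N] {ϑ g : ℝ}
    (hg : energyOpNorm V (relaxedResidual N V ϑ) ≤ g) (m : ℕ) (v : H1per d) :
    energyNorm V ((h.residualLinear N ϑ ^ m) v) ≤ g ^ m * energyNorm V v := by
  have hg0 : 0 ≤ g := (energyOpNorm_nonneg _ _).trans hg
  rw [h.residualLinear_pow_apply]
  induction m with
  | zero => simp
  | succ m ih =>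
    rw [Function.iterate_succ_apply']
    refine (h.energyNorm_relaxedResidual_le N hg _).trans ?_
    rw [pow_succ' g, mul_assoc]
    exact mul_le_mul_of_nonneg_left ih hg0

/-- Contraction of the inexact iteration on the `L²`-orthogonal complement of the first `K`
eigenfunctions. -/
theorem energyNorm_step_iterate_le (N : ℕ) [NeZero N] {u : ℕ → H1per d} {E : ℕ → ℝ}
    (hE : IsEigenbasis V u E) (hpos : ∀ i, 0 < E i) {ϑ g C₁ : ℝ} {m k K : ℕ}
    (hg : energyOpNorm V (relaxedResidual N V ϑ) ≤ g) (hC₁ : 0 < C₁) (hgap : E 0 / E K < 1)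
    (hgd : g ^ m ≤ (1 - E 0 / E K) / 2) (hgk : g ^ m ≤ C₁ * (E 0 / E K) ^ k)
    (r : H1per d) (hr : ∀ i < K, l2inner (u i) r = 0) :
    energyNorm V ((pinvitStep N V (E 0) ϑ m)^[k] r) ≤
      2 * (1 + 2 * C₁) * Real.exp (4 * C₁) * (E 0 / E K) ^ k * energyNorm V r := by
  obtain ⟨X, _, _, _, Φ, hin, hnorm⟩ := h.exists_model
  have hg0 : 0 ≤ g := (energyOpNorm_nonneg _ _).trans hg
  have hcoord : ∀ i v, inner ℝ ((Real.sqrt (E i))⁻¹ • Φ (u i)) (Φ v) =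
      (Real.sqrt (E i))⁻¹ * (E i * l2inner (u i) v) := fun i v => by
    rw [real_inner_smul_left, hin, hE.eigen]
  -- The scaling reflects `a(u i, u i) = E i`. Energy coordinates are multiples of `L²` coordinates,
  -- so the two notions of orthogonality to the first eigenfunctions agree.
  have hon : Orthonormal ℝ fun i => (Real.sqrt (E i))⁻¹ • Φ (u i) := by
    rw [orthonormal_iff_ite]
    intro i j
    rw [real_inner_smul_right, hcoord, hE.orthonormal]
    split_ifs with hij
    · subst hij
      have h1 := Real.mul_self_sqrt (hpos i).le
      have h2 := (Real.sqrt_pos.2 (hpos i)).ne'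
      field_simp
      rw [sq, h1]
    · simp
  have hdense : ⊤ ≤ (Submodule.span ℝ (Set.range fun i =>
      (Real.sqrt (E i))⁻¹ • Φ (u i))).topologicalClosure := by
    have h1 : (Submodule.span ℝ (Set.range u)).map (Φ : H1per d →ₗ[ℝ] X) ≤
        Submodule.span ℝ (Set.range fun i => (Real.sqrt (E i))⁻¹ • Φ (u i)) := by
      rw [Submodule.map_span, Submodule.span_le]
      rintro _ ⟨_, ⟨i, rfl⟩, rfl⟩
      have h2 := (Real.sqrt_pos.2 (hpos i)).ne'
      have h3 : (Φ : H1per d →ₗ[ℝ] X) (u i) =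
          Real.sqrt (E i) • ((Real.sqrt (E i))⁻¹ • Φ (u i)) := by
        rw [smul_smul, mul_inv_cancel₀ h2, one_smul]; rfl
      rw [h3]
      exact Submodule.smul_mem _ _ (Submodule.subset_span ⟨i, rfl⟩)
    intro x _
    have h2 : Φ.symm x ∈ closure (Submodule.span ℝ (Set.range u) : Set (H1per d)) := by
      have : Φ.symm x ∈ (Submodule.span ℝ (Set.range u)).topologicalClosure := by
        rw [hE.complete]; trivial
      exact this
    have h3 := image_closure_subset_closure_image Φ.continuous (Set.mem_image_of_mem Φ h2)
    rw [Φ.apply_symm_apply] at h3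
    exact closure_mono (fun y hy => h1 hy) h3
  let e : HilbertBasis ℕ ℝ X := HilbertBasis.mk hon hdense
  have he : ∀ i, e i = (Real.sqrt (E i))⁻¹ • Φ (u i) := fun i => by
    rw [HilbertBasis.coe_mk]
  have hl0 : ∀ i, 0 ≤ E 0 / E i := fun i => div_nonneg (hpos 0).le (hpos i).le
  have hl1 : ∀ i, E 0 / E i ≤ 1 := fun i =>
    (div_le_one (hpos i)).2 (hE.monotone (Nat.zero_le i))
  have hl : Antitone fun i => E 0 / E i := fun i j hij =>
    div_le_div_of_nonneg_left (hpos 0).le (hpos i) (hE.monotone hij)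
  let B₀ : X →ₗ[ℝ] X := (Φ : H1per d →ₗ[ℝ] X) ∘ₗ (E 0 • h.solveLinear) ∘ₗ
    (Φ.symm : X →ₗ[ℝ] H1per d)
  have hB₀ : ∀ v, B₀ (Φ v) = Φ (E 0 • solve V v) := fun v => by
    change Φ (E 0 • solve V (Φ.symm (Φ v))) = _
    rw [Φ.symm_apply_apply]
  have hBe : ∀ i x, inner ℝ (e i) (B₀ x) = E 0 / E i * inner ℝ (e i) x := fun i x => by
    obtain ⟨v, rfl⟩ := Φ.surjective x
    have h1 : E i * l2inner (u i) (solve V v) = l2inner (u i) v := by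
      rw [← hE.eigen, energyForm_comm, h.solve_spec]
      exact real_inner_comm _ _
    have h2 : l2inner (u i) (E 0 • solve V v) = E 0 * l2inner (u i) (solve V v) := by
      simp [← l2CLM_apply]
    rw [hB₀, he, hcoord, hcoord, h2]
    rw [← h1]
    have := (hpos i).ne'
    field_simp
  let B : X →L[ℝ] X := B₀.mkContinuous 1 fun x =>
    norm_le_of_coord e zero_le_one fun i => by
      rw [hBe, abs_mul, abs_of_nonneg (hl0 i)]
      exact mul_le_mul_of_nonneg_right (hl1 i) (abs_nonneg _)
  let M₀ : X →ₗ[ℝ] X := (Φ : H1per d →ₗ[ℝ] X) ∘ₗ (h.residualLinear N ϑ ^ m) ∘ₗ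
    (Φ.symm : X →ₗ[ℝ] H1per d)
  have hM₀ : ∀ v, M₀ (Φ v) = Φ ((h.residualLinear N ϑ ^ m) v) := fun v => by
    change Φ ((h.residualLinear N ϑ ^ m) (Φ.symm (Φ v))) = _
    rw [Φ.symm_apply_apply]
  have hMb : ∀ x, ‖M₀ x‖ ≤ g ^ m * ‖x‖ := fun x => by
    obtain ⟨v, rfl⟩ := Φ.surjective x
    rw [hM₀, hnorm, hnorm]
    exact h.energyNorm_residual_pow_le N hg m v
  let M : X →L[ℝ] X := M₀.mkContinuous (g ^ m) hMb
  have hS : ∀ j v, Φ ((pinvitStep N V (E 0) ϑ m)^[j] v) =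
      (fun x => B x + M (x - B x))^[j] (Φ v) := by
    intro j v
    induction j with
    | zero => rfl
    | succ j ih =>
      rw [Function.iterate_succ_apply', Function.iterate_succ_apply', ← ih, h.pinvitStep_eq]
      generalize (pinvitStep N V (E 0) ϑ m)^[j] v = w
      change _ = B₀ (Φ w) + M₀ (Φ w - B₀ (Φ w))
      rw [hB₀, ← map_sub, hM₀, map_add]
  rw [← hnorm, ← hnorm, hS]
  refine norm_iterate_le_of_diagonal e B M (l := fun i => E 0 / E i) hl0 hl1 hl hBe
    (div_pos (hpos 0) (hpos K)) hgap (by positivity) hC₁ hgd hgk hMb (Φ r) fun i hi => ?_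
  rw [he, hcoord, hr i hi]
  simp

end CoercivePotential

/-- The number of inner steps grows at most linearly in the number of outer steps. -/
theorem mul_le_of_minimal {g q C₁ : ℝ} {k m : ℕ} (hg : 0 ≤ g) (hq : 0 < q) (hq1 : q < 1)
    (hC₁ : 0 < C₁) (hk : 0 < k) (hgd : g ^ m ≤ (1 - q) / 2)
    (hmin : ∀ m' < m, ¬ (g ^ m' ≤ (1 - q) / 2 ∧ g ^ m' ≤ C₁ * q ^ k)) :
    ((k * m : ℕ) : ℝ) ≤ (1 + (Real.log (1 / q) + Real.log (2 / (1 - q)) +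
      Real.log (1 + 1 / C₁)) / Real.log (1 / g)) * (k : ℝ) ^ 2 := by
  have hk1 : (1 : ℝ) ≤ k := by exact_mod_cast hk
  have hd : 0 < 1 - q := by linarith
  have hm : m ≠ 0 := by
    rintro rfl
    rw [pow_zero] at hgd
    linarith
  obtain ⟨n, rfl⟩ := Nat.exists_eq_succ_of_ne_zero hm
  have hg1 : g < 1 := by
    by_contra! hge
    have := one_le_pow₀ hge (n := n.succ)
    linarith
  have L1 : 0 ≤ Real.log (1 / q) := Real.log_nonneg (by rw [le_div_iff₀ hq]; linarith)
  have L2 : 0 ≤ Real.log (2 / (1 - q)) := Real.log_nonneg (by rw [le_div_iff₀ hd]; linarith)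
  have L3 : 0 ≤ Real.log (1 + 1 / C₁) := Real.log_nonneg (by
    have : 0 < 1 / C₁ := by positivity
    linarith)
  set Λ := Real.log (1 / q) + Real.log (2 / (1 - q)) + Real.log (1 + 1 / C₁) with hΛ
  -- By minimality one of the two conditions fails for `n = m - 1`; taking logarithms bounds `n *
  -- log (1 / g)` in either case, and `1 ≤ k` merges the two bounds.
  have hn : (n : ℝ) ≤ k * (Λ / Real.log (1 / g)) := by
    -- For `g = 0` one inner step suffices, and the conventions `1 / 0 = 0`, `log 0 = 0` turn the
    -- factor into 1.
    rcases hg.eq_or_lt with h0 | h0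
    · have hn0 : n = 0 := by
        by_contra hne
        refine hmin 1 (by omega) ?_
        rw [← h0, pow_one]
        exact ⟨by linarith, by positivity⟩
      rw [hn0, ← h0]
      simp
    · have hlg : 0 < Real.log (1 / g) := Real.log_pos (by rw [lt_div_iff₀ h0]; linarith)
      rw [← mul_div_assoc, le_div_iff₀ hlg]
      have hpow : Real.log (1 / g ^ n) = n * Real.log (1 / g) := by
        rw [← Real.log_pow, div_pow, one_pow]
      rw [← hpow]
      have hgn : 0 < g ^ n := by positivity
      have hqk : Real.log (1 / q ^ k) = k * Real.log (1 / q) := by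
        rw [← Real.log_pow, div_pow, one_pow]
      have hfail := hmin n (by omega)
      rw [not_and_or, not_le, not_le] at hfail
      rcases hfail with hf | hf
      · have h1 : Real.log (1 / g ^ n) ≤ Real.log (2 / (1 - q)) := by
          refine Real.log_le_log (by positivity) ?_
          rw [div_le_div_iff₀ hgn hd]
          linarith
        nlinarith
      · have h1 : Real.log (1 / g ^ n) ≤ Real.log ((1 + 1 / C₁) * (1 / q ^ k)) := by
          refine Real.log_le_log (by positivity) ?_
          have h2 : 1 / g ^ n ≤ 1 / (C₁ * q ^ k) := one_div_le_one_div_of_le (by positivity) hf.le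
          refine h2.trans ?_
          rw [← one_div_mul_one_div]
          have : 0 < 1 / q ^ k := by positivity
          nlinarith
        rw [Real.log_mul (by positivity) (by positivity), hqk] at h1
        nlinarith
  have e : ((k * n.succ : ℕ) : ℝ) = k * (n + 1) := by push_cast; ring
  rw [e]
  have h1 : (k : ℝ) * n ≤ k * (k * (Λ / Real.log (1 / g))) := by gcongr
  nlinarith

end Convergence

/-! ### Growth of supports -/

section Support

variable {d N : ℕ} {V : (Fin d → ℝ) → ℝ}

/-- Elements of `H¹_per(D)` vanishing outside a set of mesh cells. -/
def supportedOn (d N : ℕ) (T : Set (Fin d → ZMod N)) : Submodule ℝ (H1per d) where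
  carrier := {v | ∀ᵐ x ∂((volume : Measure (Fin d → ℝ)).restrict (cube d)),
    cellOf N x ∉ T → fnOf v x = 0}
  zero_mem' := by
    filter_upwards [Lp.coeFn_zero ℝ 2 ((volume : Measure (Fin d → ℝ)).restrict (cube d))]
      with x hx _
    exact hx
  add_mem' := by
    intro u v hu hv
    filter_upwards [hu, hv, Lp.coeFn_add (fnOf u) (fnOf v)] with x h1 h2 h3 hx
    have : fnOf (u + v) x = fnOf u x + fnOf v x := h3
    rw [this, h1 hx, h2 hx, add_zero]
  smul_mem' := by
    intro c v hv
    filter_upwards [hv, Lp.coeFn_smul c (fnOf v)] with x h1 h2 hx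
    have : fnOf (c • v) x = c * fnOf v x := h2
    rw [this, h1 hx, mul_zero]

theorem mem_supportedOn {T : Set (Fin d → ZMod N)} {v : H1per d} :
    v ∈ supportedOn d N T ↔ ∀ᵐ x ∂((volume : Measure (Fin d → ℝ)).restrict (cube d)),
      cellOf N x ∉ T → fnOf v x = 0 := Iff.rfl

theorem supportedOn_mono {T T' : Set (Fin d → ZMod N)} (hT : T ⊆ T') :
    supportedOn d N T ≤ supportedOn d N T' := by
  intro v hv
  filter_upwards [mem_supportedOn.1 hv] with x hx h
  exact hx fun h' => h (hT h')

/-- Restriction of `L²` functions to the complementary cells is continuous. Closedness is needed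
because the local spaces are closures of smooth functions. -/
theorem isClosed_supportedOn (T : Set (Fin d → ZMod N)) :
    IsClosed (supportedOn d N T : Set (H1per d)) := by
  have hm : MeasurableSet {x : Fin d → ℝ | cellOf N x ∈ T}ᶜ :=
    (measurableSet_cellOf_mem N T).compl
  let R := LpToLpRestrictCLM (Fin d → ℝ) ℝ ℝ ((volume : Measure (Fin d → ℝ)).restrict (cube d)) 2
    {x : Fin d → ℝ | cellOf N x ∈ T}ᶜ
  have hset : (supportedOn d N T : Set (H1per d)) = {v | R v.1.1 = 0} := by
    ext v
    have h1 : R v.1.1 = 0 ↔ fnOf v =ᵐ[((volume : Measure (Fin d → ℝ)).restrict (cube d)).restrict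
        {x : Fin d → ℝ | cellOf N x ∈ T}ᶜ] 0 := by
      rw [Lp.eq_zero_iff_ae_eq_zero]
      have h2 := LpToLpRestrictCLM_coeFn ℝ {x : Fin d → ℝ | cellOf N x ∈ T}ᶜ (fnOf v)
      exact ⟨fun h => h2.symm.trans h, fun h => h2.trans h⟩
    rw [Set.mem_ofPred_eq, h1, Filter.EventuallyEq, ae_restrict_iff' hm]
    rfl
  rw [hset]
  exact isClosed_eq (by fun_prop) continuous_const

/-- The cells of the patch `D_z`. -/
def patchCells (N : ℕ) (z : Fin d → ZMod N) : Set (Fin d → ZMod N) :=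
  {c | ∀ i, c i = z i ∨ c i = z i - 1}

theorem cellOf_mem_patchCells {z : Fin d → ZMod N} {x : Fin d → ℝ} (hx : x ∈ patch N z) :
    cellOf N x ∈ patchCells N z := by
  obtain ⟨n, hn⟩ := hx
  intro i
  obtain ⟨h1, h2⟩ := hn i
  rw [abs_lt] at h2
  -- A node is the lower corner of the cell with the same index; the strict bound in `patch` leaves
  -- only the offsets 0 and -1.
  have h3 : n i - 1 ≤ ⌊(N : ℝ) * x i⌋ := by
    rw [Int.le_floor]; push_cast; linarith
  have h4 : ⌊(N : ℝ) * x i⌋ < n i + 1 := by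
    rw [Int.floor_lt]; push_cast; linarith
  have h5 : ⌊(N : ℝ) * x i⌋ = n i ∨ ⌊(N : ℝ) * x i⌋ = n i - 1 := by omega
  rcases h5 with h5 | h5
  · left; rw [cellOf, h5, h1]
  · right; rw [cellOf, h5]; push_cast; rw [h1]

theorem localSpace_le_supportedOn (z : Fin d → ZMod N) :
    localSpace N z ≤ supportedOn d N (patchCells N z) := by
  refine Submodule.topologicalClosure_minimal _ (Submodule.span_le.2 ?_)
    (isClosed_supportedOn _)
  rintro w ⟨φ, -, hsupp, hw⟩
  refine mem_supportedOn.2 ?_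
  filter_upwards [hw] with x hx hc
  rw [hx]
  by_contra hne
  exact hc (cellOf_mem_patchCells (hsupp (subset_tsupport φ hne)))

theorem ae_eq_zero_on_patch {T : Set (Fin d → ZMod N)} {z : Fin d → ZMod N}
    (hT : Disjoint T (patchCells N z)) {v : H1per d} (hv : v ∈ supportedOn d N T) :
    ∀ᵐ x ∂((volume : Measure (Fin d → ℝ)).restrict (cube d)), x ∈ patch N z → fnOf v x = 0 := by
  filter_upwards [mem_supportedOn.1 hv] with x hx hp
  exact hx fun h => Set.disjoint_left.1 hT h (cellOf_mem_patchCells hp)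

/-- The union of `j` layers of cells around `T` and `T` itself. -/
def layers (j : ℕ) (T : Set (Fin d → ZMod N)) : Set (Fin d → ZMod N) :=
  {c' | ∃ c ∈ T, WithinLayers j c c'}

theorem layers_mono {i j : ℕ} (hij : i ≤ j) (T : Set (Fin d → ZMod N)) :
    layers i T ⊆ layers j T := by
  rintro c' ⟨c, hc, hw⟩
  refine ⟨c, hc, fun l => ?_⟩
  obtain ⟨t, ht, he⟩ := hw l
  exact ⟨t, ht.trans (by exact_mod_cast hij), he⟩

theorem layers_layers (i j : ℕ) (T : Set (Fin d → ZMod N)) :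
    layers i (layers j T) ⊆ layers (j + i) T := by
  rintro c'' ⟨c', ⟨c, hc, hw⟩, hw'⟩
  refine ⟨c, hc, fun l => ?_⟩
  obtain ⟨t, ht, he⟩ := hw l
  obtain ⟨t', ht', he'⟩ := hw' l
  refine ⟨t + t', ?_, ?_⟩
  · push_cast
    exact (abs_add_le t t').trans (add_le_add ht ht')
  · rw [he', he]; push_cast; ring

theorem subset_layers (j : ℕ) (T : Set (Fin d → ZMod N)) : T ⊆ layers j T :=
  fun c hc => ⟨c, hc, fun _ => ⟨0, by simp, by simp⟩⟩

theorem patchCells_subset_layers {T : Set (Fin d → ZMod N)}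
    (z c : Fin d → ZMod N) (hc : c ∈ T) (hcz : c ∈ patchCells N z) :
    patchCells N z ⊆ layers 1 T := by
  intro c' hc'
  refine ⟨c, hc, fun i => ?_⟩
  rcases hcz i with h1 | h1 <;> rcases hc' i with h2 | h2
  · exact ⟨0, by simp, by rw [h1, h2]; simp⟩
  · exact ⟨-1, by simp, by rw [h1, h2]; push_cast; ring⟩
  · exact ⟨1, by simp, by rw [h1, h2]; push_cast; ring⟩
  · exact ⟨0, by simp, by rw [h1, h2]; simp⟩

namespace CoercivePotential

variable (h : CoercivePotential V)
include h

/-- For smooth `φ` supported in the patch, a second integration by parts gives `∫ ∂ᵢv ∂ᵢφ = -∫ v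
∂ᵢ²φ = 0`, so it need not be known that `∇v` vanishes where `v` does. Closures follow by continuity.
-/
theorem energyForm_eq_zero_of_disjoint {T : Set (Fin d → ZMod N)} {z : Fin d → ZMod N}
    (hT : Disjoint T (patchCells N z)) {v : H1per d} (hv : v ∈ supportedOn d N T)
    {w : H1per d} (hw : w ∈ localSpace N z) : energyForm V v w = 0 ∧ l2inner v w = 0 := by
  obtain ⟨a, ha⟩ := h.exists_form
  have hv0 := ae_eq_zero_on_patch hT hv
  have hzero : ∀ φ : (Fin d → ℝ) → ℝ, (∀ x, φ x ≠ 0 → x ∈ patch N z) →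
      ∫ x in cube d, fnOf v x * φ x = 0 := by
    intro φ hφ
    rw [integral_eq_zero_of_ae]
    filter_upwards [hv0] with x hx
    by_cases hne : φ x = 0
    · simp [hne]
    · simp [hx (hφ x hne)]
  have hle : localSpace N z ≤ LinearMap.ker (a v : H1per d →ₗ[ℝ] ℝ) ⊓
      LinearMap.ker (l2CLM d v : H1per d →ₗ[ℝ] ℝ) := by
    refine Submodule.topologicalClosure_minimal _ (Submodule.span_le.2 ?_)
      ((a v).isClosed_ker.inter (l2CLM d v).isClosed_ker)
    rintro w ⟨φ, hφ, hsupp, hw⟩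
    have hpatch : ∀ x, φ x ≠ 0 → x ∈ patch N z := fun x hx => hsupp (subset_tsupport φ hx)
    constructor
    · change a v w = 0
      rw [ha, energyForm]
      have h1 : ∫ x in cube d, V x * fnOf v x * fnOf w x = 0 := by
        rw [integral_eq_zero_of_ae]
        filter_upwards [hv0, hw] with x hx hwx
        rw [hwx]
        by_cases hne : φ x = 0
        · simp [hne]
        · simp [hx (hpatch x hne)]
      have h2 : ∀ i, inner ℝ (gradOf v i) (gradOf w i) = 0 := by
        intro i
        have e1 : inner ℝ (gradOf v i) (gradOf w i) =
            ∫ x in cube d, gradOf v i x * partialDeriv i φ x := by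
          rw [inner_eq_integral_mul]
          refine integral_congr_ae ?_
          filter_upwards [gradOf_ae_eq hφ hw i] with x hx
          rw [hx]
        have e2 := v.2 i _ (hφ.partialDeriv i)
        have e3 : ∫ x in cube d, fnOf v x * partialDeriv i (partialDeriv i φ) x = 0 := by
          refine hzero _ fun x hx => hsupp ?_
          by_contra hnot
          refine hx ?_
          have h3 : (tsupport φ)ᶜ ∈ nhds x := (isClosed_tsupport φ).isOpen_compl.mem_nhds hnot
          have h4 : φ =ᶠ[nhds x] fun _ => 0 := by
            filter_upwards [h3] with y hy
            exact image_eq_zero_of_notMem_tsupport hy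
          have h5 : partialDeriv i φ =ᶠ[nhds x] fun _ => 0 := by
            filter_upwards [h4.fderiv (𝕜 := ℝ)] with y hy
            simp [partialDeriv, hy]
          simp only [partialDeriv]
          have h6 := (h5.fderiv (𝕜 := ℝ)).self_of_nhds
          have h7 : fderiv ℝ (partialDeriv i φ) x = 0 := by rw [h6]; simp
          have h8 : fderiv ℝ (fun y => (fderiv ℝ φ y) (Pi.single i 1)) x = 0 := h7
          have h9 : partialDeriv i φ = fun y => (fderiv ℝ φ y) (Pi.single i 1) := rfl
          rw [h9, h8]; rfl
        have e4 : ∫ x in cube d, fnOf v x * partialDeriv i (partialDeriv i φ) x =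
          -∫ x in cube d, gradOf v i x * partialDeriv i φ x := e2
        rw [e1]
        linarith
      rw [h1, Finset.sum_eq_zero fun i _ => h2 i, add_zero]
    · change l2inner v w = 0
      rw [l2inner, inner_eq_integral_mul, ← hzero φ hpatch]
      refine integral_congr_ae ?_
      filter_upwards [hw] with x hx
      rw [hx]
  have := hle hw
  refine ⟨?_, this.2⟩
  rw [← ha]
  exact this.1

/-- One sweep of local corrections enlarges the support by one layer of cells. -/
theorem schwarzOp_mem_supportedOn [NeZero N] {T T' : Set (Fin d → ZMod N)}
    (hT' : ∀ z c, c ∈ T → c ∈ patchCells N z → patchCells N z ⊆ T') (r : ℝ) {v w : H1per d}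
    (hv : v ∈ supportedOn d N T) (hw : w ∈ supportedOn d N T) :
    schwarzOp N V (r • solve V v - w) ∈ supportedOn d N T' := by
  refine Submodule.sum_mem _ fun z _ => ?_
  obtain ⟨hmem, hspec⟩ := h.localProj_spec N z (r • solve V v - w)
  by_cases hdis : Disjoint T (patchCells N z)
  · have h0 : localProj N V z (r • solve V v - w) = 0 := by
      -- The nonlocal function `solve V v` enters only through its pairing with local `y`, which
      -- equals the `L²` product of `v` and `y`.
      refine h.unique_riesz hmem (Submodule.zero_mem _) fun y hy => ?_
      rw [hspec y hy, h.sub_left, h.smul_left, h.solve_spec,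
        (h.energyForm_eq_zero_of_disjoint hdis hv hy).2,
        (h.energyForm_eq_zero_of_disjoint hdis hw hy).1]
      have := h.smul_left 0 0 y
      rw [zero_smul] at this
      rw [this]; simp
    rw [h0]
    exact Submodule.zero_mem _
  · obtain ⟨c, hcT, hcz⟩ := Set.not_disjoint_iff.1 hdis
    exact supportedOn_mono (hT' z c hcT hcz) (localSpace_le_supportedOn z hmem)

theorem pinvitStep_mem_supportedOn [NeZero N] {T : Set (Fin d → ZMod N)} (E₁ ϑ : ℝ) (m : ℕ)
    {v : H1per d} (hv : v ∈ supportedOn d N T) :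
    pinvitStep N V E₁ ϑ m v ∈ supportedOn d N (layers m T) := by
  have hpre : ∀ j, precond N V ϑ j (E₁ • solve V v - v) ∈ supportedOn d N (layers j T) := by
    intro j
    induction j with
    | zero => exact Submodule.zero_mem _
    | succ j ih =>
      rw [precond] at ih ⊢
      rw [Function.iterate_succ_apply']
      generalize (fun w => w + ϑ • schwarzOp N V (E₁ • solve V v - v - w))^[j] 0 = w at ih
      refine Submodule.add_mem _ (supportedOn_mono (layers_mono j.le_succ T) ih)
        (Submodule.smul_mem _ _ ?_)
      -- The inner residual is `E₁ • solve V v - (v + w)`, and both `v` and `v + w` live on the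
      -- layers reached so far.
      rw [sub_sub]
      have hv' := supportedOn_mono (subset_layers j T) hv
      exact supportedOn_mono (layers_layers 1 j T)
        (h.schwarzOp_mem_supportedOn patchCells_subset_layers E₁ hv'
          (Submodule.add_mem _ hv' ih))
  exact Submodule.add_mem _ (supportedOn_mono (subset_layers m T) hv) (hpre m)

theorem pinvitStep_iterate_mem_supportedOn [NeZero N] {T : Set (Fin d → ZMod N)} (E₁ ϑ : ℝ)
    (m k : ℕ) {v : H1per d} (hv : v ∈ supportedOn d N T) :
    (pinvitStep N V E₁ ϑ m)^[k] v ∈ supportedOn d N (layers (k * m) T) := by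
  induction k with
  | zero => exact supportedOn_mono (subset_layers _ T) hv
  | succ k ih =>
    rw [Function.iterate_succ_apply', Nat.succ_mul]
    exact supportedOn_mono (layers_layers m (k * m) T)
      (h.pinvitStep_mem_supportedOn E₁ ϑ m ih)

theorem supportGrowth_of_mem_span [NeZero N] {K : ℕ} (V₀ : Fin K → H1per d) (E₁ ϑ : ℝ)
    (m k : ℕ) {v : H1per d}
    (hv : v ∈ Submodule.span ℝ (Set.range (pinvitBlock N V E₁ ϑ m k V₀))) :
    SupportGrowth N (k * m) V₀ v := by
  set T : Set (Fin d → ZMod N) := {c | ∃ l, MeetsCell N (V₀ l) c} with hT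
  have h0 : ∀ l, V₀ l ∈ supportedOn d N T := by
    intro l
    have h1 : ∀ c : Fin d → ZMod N, c ∉ T →
        ∀ᵐ x ∂((volume : Measure (Fin d → ℝ)).restrict (cube d)),
          cellOf N x = c → fnOf (V₀ l) x = 0 := fun c hc => by
      by_contra hne
      exact hc ⟨l, hne⟩
    -- The mesh has finitely many cells, so the exceptional null sets can be united.
    have h2 : ∀ᵐ x ∂((volume : Measure (Fin d → ℝ)).restrict (cube d)),
        ∀ c : Fin d → ZMod N, c ∉ T → cellOf N x = c → fnOf (V₀ l) x = 0 := by
      rw [ae_all_iff]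
      intro c
      by_cases hc : c ∈ T
      · exact Filter.Eventually.of_forall fun x h' => absurd hc h'
      · filter_upwards [h1 c hc] with x hx _ using hx
    refine mem_supportedOn.2 ?_
    filter_upwards [h2] with x hx hc using hx _ hc rfl
  have hmem : v ∈ supportedOn d N (layers (k * m) T) := by
    refine Submodule.span_le.2 ?_ hv
    rintro _ ⟨l, rfl⟩
    exact h.pinvitStep_iterate_mem_supportedOn E₁ ϑ m k (h0 l)
  intro c' hc'
  by_contra hnot
  refine hc' ?_
  filter_upwards [mem_supportedOn.1 hmem] with x hx hc
  refine hx ?_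
  rintro ⟨c, ⟨l, hl⟩, hw⟩
  exact hnot ⟨c, ⟨l, hl⟩, hc ▸ hw⟩

end CoercivePotential

end Support

end Schroedinger

end

/-! ### The convergence theorem -/

open Schroedinger in
theorem mainTheorem3 (C₁ : ℝ) (hC₁ : 0 < C₁) : ∃ C : ℝ, 0 < C ∧
    ∀ (d : ℕ) (_ : 1 ≤ d) (N : ℕ) [NeZero N] (Tβ : Set (Fin d → ZMod N)) (_ : Tβ.Nonempty)
      (α β c₀ : ℝ) (_ : 0 ≤ α) (_ : α ≤ β) (_ : 0 < c₀) (_ : c₀ * (1 / (N : ℝ)) ^ (-2 : ℤ) ≤ β)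
      (u : ℕ → H1per d) (E : ℕ → ℝ) (_ : IsEigenbasis (potential N Tβ α β) u E)
      (K : ℕ) (hK : 0 < K) (gap : ℝ) (_ : gap = E 0 / E K) (_ : gap < 1)
      (V₀ : Fin K → H1per d) (_ : IsUnit (coeffMatrix u V₀))
      (tol : ℝ) (_ : 0 < tol) (_ : tol < 1)
      (k : ℕ) (_ : Real.log (1 / tol) / Real.log (1 / gap) ≤ k)
      (ϑ γP : ℝ) (_ : energyOpNorm (potential N Tβ α β)
        (relaxedResidual N (potential N Tβ α β) ϑ) ≤ γP)
      (m : ℕ) (_ : γP ^ m ≤ (1 - gap) / 2) (_ : γP ^ m ≤ C₁ * gap ^ k),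
      (∃ v ∈ Submodule.span ℝ
          (Set.range (pinvitBlock N (potential N Tβ α β) (E 0) ϑ m k V₀)),
        energyNorm (potential N Tβ α β) (v - u 0) ≤
          C * tol * energyNorm (potential N Tβ α β)
            (blockComb V₀ ((coeffMatrix u V₀)⁻¹.mulVec (Pi.single ⟨0, hK⟩ 1)) - u 0) ∧
        SupportGrowth N (k * m) V₀ v) ∧
      ((∀ m' < m, ¬ (γP ^ m' ≤ (1 - gap) / 2 ∧ γP ^ m' ≤ C₁ * gap ^ k)) →
        ((k * m : ℕ) : ℝ) ≤
          (1 + (Real.log (1 / gap) + Real.log (2 / (1 - gap)) + Real.log (1 + 1 / C₁)) /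
            Real.log (1 / γP)) * (k : ℝ) ^ 2) := by
  refine ⟨2 * (1 + 2 * C₁) * Real.exp (4 * C₁), by positivity, ?_⟩
  intro d _ N _ Tβ hT α β c₀ hα hαβ hc₀ hβ u E hE K hK gap hgap hgap1 V₀ hC tol htol htol1 k hk ϑ γP
    hγP m hm1 hm2
  have hN : (0 : ℝ) < N := Nat.cast_pos.2 (NeZero.pos N)
  have hβ0 : 0 < β := lt_of_lt_of_le (by positivity) hβ
  have hpos := eigenvalue_pos hT hα hαβ hβ0 hE
  have hco : CoercivePotential (potential N Tβ α β) :=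
    coercivePotential_of_eigenbasis (measurable_potential N Tβ α β) (potential_nonneg hα hαβ)
      (norm_potential_le hα hαβ) hE (hpos 0)
  have hγ0 : 0 ≤ γP := (energyOpNorm_nonneg _ _).trans hγP
  subst hgap
  have hgap0 : 0 < E 0 / E K := div_pos (hpos 0) (hpos K)
  have hlg : 0 < Real.log (1 / (E 0 / E K)) := Real.log_pos (by rw [lt_div_iff₀ hgap0]; linarith)
  have hlt : 0 < Real.log (1 / tol) := Real.log_pos (by rw [lt_div_iff₀ htol]; linarith)
  have hk0 : 0 < k := by
    have : (0 : ℝ) < k := lt_of_lt_of_le (div_pos hlt hlg) hk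
    exact_mod_cast this
  have htolk : (E 0 / E K) ^ k ≤ tol := by
    rw [div_le_iff₀ hlg, ← Real.log_pow, div_pow, one_pow] at hk
    have h1 := (Real.log_le_log_iff (by positivity) (by positivity)).1 hk
    exact (one_div_le_one_div htol (by positivity)).1 h1
  refine ⟨?_, fun hmin => mul_le_of_minimal hγ0 hgap0 hgap1 hC₁ hk0 hm1 hmin⟩
  -- With these weights the combination has coefficients `1, 0, …, 0` on the first `K`
  -- eigenfunctions.
  set x := (coeffMatrix u V₀)⁻¹.mulVec (Pi.single ⟨0, hK⟩ 1) with hx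
  set S := hco.stepLinear N (E 0) ϑ m ^ k with hS
  have hSapp : ∀ v, S v = (pinvitStep N (potential N Tβ α β) (E 0) ϑ m)^[k] v :=
    hco.stepLinear_pow_apply N (E 0) ϑ m k
  have hmem : S (blockComb V₀ x) ∈ Submodule.span ℝ
      (Set.range (pinvitBlock N (potential N Tβ α β) (E 0) ϑ m k V₀)) := by
    rw [blockComb, map_sum]
    refine Submodule.sum_mem _ fun j _ => ?_
    rw [map_smul, hSapp]
    exact Submodule.smul_mem _ _ (Submodule.subset_span ⟨j, rfl⟩)
  refine ⟨S (blockComb V₀ x), hmem, ?_, hco.supportGrowth_of_mem_span V₀ (E 0) ϑ m k hmem⟩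
  -- The exact residual of `u 0` vanishes, so the inexactness of the preconditioner has no effect on
  -- it; by linearity the error after `k` steps is `S` applied to the initial error.
  have hfix : S (u 0) = u 0 := by
    rw [hSapp]
    refine Function.iterate_fixed ?_ k
    rw [hco.pinvitStep_eq, hco.solve_eigen hE, sub_self, map_zero, add_zero]
  have hr : ∀ i < K, l2inner (u i) (blockComb V₀ x - u 0) = 0 := by
    intro i hi
    have h1 : l2inner (u i) (blockComb V₀ x) = (coeffMatrix u V₀).mulVec x ⟨i, hi⟩ := by
      rw [blockComb, ← l2CLM_apply, map_sum]
      simp only [map_smul, l2CLM_apply, smul_eq_mul, Matrix.mulVec, dotProduct, coeffMatrix,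
        Matrix.of_apply]
      exact Finset.sum_congr rfl fun j _ => mul_comm _ _
    have h2 : (coeffMatrix u V₀).mulVec x = Pi.single ⟨0, hK⟩ 1 := by
      rw [hx, Matrix.mulVec_mulVec, Matrix.mul_nonsing_inv _
        ((Matrix.isUnit_iff_isUnit_det _).1 hC), Matrix.one_mulVec]
    rw [← l2CLM_apply, map_sub, l2CLM_apply, l2CLM_apply, h1, h2, hE.orthonormal,
      Pi.single_apply]
    simp [Fin.ext_iff]
  have key := hco.energyNorm_step_iterate_le N hE hpos hγP hC₁ hgap1 hm1 hm2 _ hr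
  rw [← hSapp, map_sub, hfix] at key
  refine key.trans ?_
  have hn : 0 ≤ energyNorm (potential N Tβ α β) (blockComb V₀ x - u 0) := Real.sqrt_nonneg _
  gcongr
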